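/- Let $(X_1,Y_1,X_2,Y_2)$ be zero-mean jointly Gaussian with $\sigma^2_{Y_1},\sigma^2_{Y_2}>0$. Agent A observes the public sequence $X_1^n$ and has the private sequence $Y_1^n$; agent B observes $X_2^n$ and has $Y_2^n$; the four sequences consist of $n$ i.i.d. copies of $(X_1,Y_1,X_2,Y_2)$. In a $K$-round interactive mechanism ($K\ge 2$ even) message $U_k^n$ is drawn by a probabilistic mapping from $(X_1^n,U_1^n,\dots,U_{k-1}^n)$ for odd $k$, and from $(X_2^n,U_1^n,\dots,U_{k-1}^n)$ for even $k$, with arbitrary message alphabets. At the end agent B forms $\hat X_1^n=g_1(X_2^n,U_1^n,\dots,U_K^n)$ and agent A forms $\hat X_2^n=g_2(X_1^n,U_1^n,\dots,U_K^n)$. The leakage–distortion region is the set of all real tuples $(L_1,L_2,D_1,D_2)$ for which there is a sequence of such mechanisms (one for each $n$, the alphabets being fixed) with $$\limsup_n \frac1n\sum_{i=1}^n\mathbb E\big(X_{ji}-\hat X_{ji}\big)^2\le D_j\quad(j=1,2),$$ $$\limsup_n\frac1n I(Y_1^n;U_1^n,\dots,U_K^n,X_2^n)\le L_1,\qquad \limsup_n\frac1n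 I(Y_2^n;U_1^n,\dots,U_K^n,X_1^n)\le L_2 .$$ Write $\sigma^2_{A|B}=\mathbb E[\mathrm{Var}(A|B)]$, let $\alpha$ be the coefficient of $X_1$ in the linear regression of $Y_1$ on $(X_1,X_2)$, and let $\beta$ be the coefficient of $X_2$ in the linear regression of $Y_2$ on $(X_1,X_2)$. Then for every even $K\ge2$ the leakage–distortion region consists of all tuples with $D_1,D_2\ge 0$ and $$L_1\ge \frac12\log\frac{\sigma^2_{Y_1}}{\alpha^2\min(D_1,\sigma^2_{X_1|X_2})+\sigma^2_{Y_1|X_1,X_2}},\qquad L_2\ge \frac12\log\frac{\sigma^2_{Y_2}}{\beta^2\min(D_2,\sigma^2_{X_2|X_1})+\sigma^2_{Y_2|X_1,X_2}},$$ where a bound with zero denominator is read as $+\infty$; logarithms and mutual information are in nats. (For $D_1\le\sigma^2_{X_1|X_2}$ the first minimum is $D_1$, for $D_2\le\sigma^2_{X_2|X_1}$ the second is $D_2$.) In particular the region does not depend on $K$. Moreover, for all $D_1,D_2\ge0$ there are noise variances $Q_1,Q_2\in[0,\infty]$, with $Q_1<\infty$ if $D_1<\sigma^2_{X_1|X_2}$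 and $Q_2<\infty$ if $D_2<\sigma^2_{X_2|X_1}$, such that all tuples $(L_1,L_2,D_1,D_2)$ of the region are achieved, with suitable reconstruction functions, by the one-shot mechanism in which each agent speaks once, without regard to the other's message, through the memoryless Gaussian test channel $U_1=X_1+V_1$, $U_2=X_2+V_2$, where $V_1\sim N(0,Q_1)$ and $V_2\sim N(0,Q_2)$ are independent of each other and of the sources ($Q_j=\infty$ meaning that agent $j$ reveals nothing). So one-shot is optimal. -/

import Mathlib

open MeasureTheory ProbabilityTheory Filter
open scoped ENNReal NNReal

noncomputable section

namespace PrivateInteraction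

/-- One letter `(x₁, y₁, x₂, y₂)` of the source. Agent A holds the public letter `x₁` and the
private letter `y₁`; agent B holds the public letter `x₂` and the private letter `y₂`. -/
abbrev Letter : Type := ℝ × ℝ × ℝ × ℝ

/-- The public letter of agent A. -/
def X₁ (s : Letter) : ℝ := s.1

/-- The private letter of agent A. -/
def Y₁ (s : Letter) : ℝ := s.2.1

/-- The public letter of agent B. -/
def X₂ (s : Letter) : ℝ := s.2.2.1

/-- The private letter of agent B. -/
def Y₂ (s : Letter) : ℝ := s.2.2.2

/-- The letterwise extension of `f` to sequences of length `n`. -/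
def seq {n : ℕ} (f : Letter → ℝ) (s : Fin n → Letter) : Fin n → ℝ := fun i => f (s i)

/-- A zero-mean jointly Gaussian source. -/
structure IsGaussianSource (P : Measure Letter) : Prop where
  gaussian : IsGaussian P
  mean_X₁ : ∫ s, X₁ s ∂P = 0
  mean_Y₁ : ∫ s, Y₁ s ∂P = 0
  mean_X₂ : ∫ s, X₂ s ∂P = 0
  mean_Y₂ : ∫ s, Y₂ s ∂P = 0

/-- The average conditional variance `𝔼[Var(f | W)]`. -/
def meanCondVar {β : Type} [MeasurableSpace β] (P : Measure Letter) (f : Letter → ℝ)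
    (W : Letter → β) : ℝ :=
  ∫ s, (condVar (MeasurableSpace.comap W inferInstance) f P) s ∂P

/-- `a` is a coefficient of `f` in the linear regression of `g` on `f` and `f'`: one can write
`g = a f + b f' + z` with a residual `z` that is uncorrelated with `f` and with `f'`. -/
def IsRegressionCoeff (P : Measure Letter) (g f f' : Letter → ℝ) (a : ℝ) : Prop :=
  ∃ b : ℝ, covariance (fun s => g s - a * f s - b * f' s) f P = 0 ∧
    covariance (fun s => g s - a * f s - b * f' s) f' P = 0

/-- The error variance `a² min(D, σ²(f | f')) + σ²(g | f, f')`, where `σ²(· | ·)` denotes the average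
conditional variance. -/
def errorVar (P : Measure Letter) (g f f' : Letter → ℝ) (a D : ℝ) : ℝ :=
  a ^ 2 * min D (meanCondVar P f f') + meanCondVar P g fun s => (f s, f' s)

/-- The leakage level `L` of the private letter `g` satisfies `L ≥ (1/2) log (σ²(g) / N)`, the right
hand side being `+∞` for `N = 0`; here `N` is the error variance above. -/
def LeakageBound (P : Measure Letter) (g f f' : Letter → ℝ) (a D L : ℝ) : Prop :=
  0 < errorVar P g f f' a D ∧
    1 / 2 * Real.log (variance g P / errorVar P g f f' a D) ≤ L

/-- Mutual information `I(A; B)` in nats, of random variables with values in arbitrary measurable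
spaces: the divergence of the joint law from the product of the marginals. -/
def mutualInfo {Ω α β : Type} [MeasurableSpace Ω] [MeasurableSpace α] [MeasurableSpace β]
    (μ : Measure Ω) (A : Ω → α) (B : Ω → β) : ℝ≥0∞ :=
  InformationTheory.klDiv (μ.map fun ω => (A ω, B ω)) ((μ.map A).prod (μ.map B))

/-- The sequences revealed in the first `k` rounds at block length `n`; the round with index `j`
(counted from `0`) reveals a sequence in `(𝒰 j)ⁿ`. -/
def Transcript (𝒰 : ℕ → Type) (n : ℕ) : ℕ → Type
  | 0 => Unit
  | k + 1 => Transcript 𝒰 n k × (Fin n → 𝒰 k)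

instance instMeasurableSpaceTranscript (𝒰 : ℕ → Type) [∀ k, MeasurableSpace (𝒰 k)] (n : ℕ) :
    (k : ℕ) → MeasurableSpace (Transcript 𝒰 n k)
  | 0 => inferInstanceAs (MeasurableSpace Unit)
  | k + 1 =>
    letI := instMeasurableSpaceTranscript 𝒰 n k
    inferInstanceAs (MeasurableSpace (Transcript 𝒰 n k × (Fin n → 𝒰 k)))

/-- A `K`-round interactive privacy mechanism at block length `n`. The message of each round is
drawn by a probabilistic mapping from the public sequence of the speaking agent and everything
revealed before; after `K` rounds, `g₁` (used by agent B) reconstructs `x₁ⁿ` from `x₂ⁿ` and the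
transcript, and `g₂` (used by agent A) reconstructs `x₂ⁿ` from `x₁ⁿ` and the transcript.
Only the maps `message k` with `k < K` matter. -/
structure Mechanism (𝒰 : ℕ → Type) [∀ k, MeasurableSpace (𝒰 k)] (n K : ℕ) where
  message : ∀ k, Kernel ((Fin n → ℝ) × Transcript 𝒰 n k) (Fin n → 𝒰 k)
  markov : ∀ k, IsMarkovKernel (message k)
  g₁ : (Fin n → ℝ) × Transcript 𝒰 n K → (Fin n → ℝ)
  g₂ : (Fin n → ℝ) × Transcript 𝒰 n K → (Fin n → ℝ)
  measurable_g₁ : Measurable g₁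
  measurable_g₂ : Measurable g₂

/-- The public sequence of the agent that speaks in the round with index `k` (counted from `0`):
agent A in rounds `0, 2, 4, …`, agent B in rounds `1, 3, 5, …`. -/
def own {n : ℕ} (k : ℕ) (x : (Fin n → ℝ) × (Fin n → ℝ)) : Fin n → ℝ :=
  if Even k then x.1 else x.2

theorem measurable_own {n : ℕ} (k : ℕ) : Measurable (own (n := n) k) := by
  unfold own
  split_ifs
  · exact measurable_fst
  · exact measurable_snd

namespace Mechanism

variable {𝒰 : ℕ → Type} [∀ k, MeasurableSpace (𝒰 k)] {n K : ℕ}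

/-- The conditional law of the first `k` messages given the public sequences `(x₁ⁿ, x₂ⁿ)`. -/
def transcriptKernel (M : Mechanism 𝒰 n K) :
    (k : ℕ) → Kernel ((Fin n → ℝ) × (Fin n → ℝ)) (Transcript 𝒰 n k)
  | 0 => Kernel.const _ (Measure.dirac ())
  | k + 1 =>
    (M.transcriptKernel k).compProd
      ((M.message k).comap
        (fun p : ((Fin n → ℝ) × (Fin n → ℝ)) × Transcript 𝒰 n k => (own k p.1, p.2))
        (((measurable_own k).comp measurable_fst).prodMk measurable_snd))

instance isMarkovKernel_transcriptKernel (M : Mechanism 𝒰 n K) (k : ℕ) :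
    IsMarkovKernel (M.transcriptKernel k) := by
  induction k with
  | zero =>
    unfold transcriptKernel
    have : IsProbabilityMeasure (α := Transcript 𝒰 n 0) (Measure.dirac ()) :=
      Measure.dirac.isProbabilityMeasure
    infer_instance
  | succ k ih =>
    have := M.markov k
    exact inferInstanceAs (IsMarkovKernel ((M.transcriptKernel k).compProd
      ((M.message k).comap
        (fun p : ((Fin n → ℝ) × (Fin n → ℝ)) × Transcript 𝒰 n k => (own k p.1, p.2))
        (((measurable_own k).comp measurable_fst).prodMk measurable_snd))))

/-- The joint law of an i.i.d. source block with letter law `P` and of all `K` messages. -/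
def law (M : Mechanism 𝒰 n K) (P : Measure Letter) :
    Measure ((Fin n → Letter) × Transcript 𝒰 n K) :=
  (Measure.pi fun _ : Fin n => P).compProd
    ((M.transcriptKernel K).comap (fun s => (seq X₁ s, seq X₂ s))
      (by unfold seq X₁ X₂; fun_prop))

/-- What agent B knows at the end: its public sequence and the transcript. -/
def viewB (p : (Fin n → Letter) × Transcript 𝒰 n K) : (Fin n → ℝ) × Transcript 𝒰 n K :=
  (seq X₂ p.1, p.2)

/-- What agent A knows at the end: its public sequence and the transcript. -/
def viewA (p : (Fin n → Letter) × Transcript 𝒰 n K) : (Fin n → ℝ) × Transcript 𝒰 n K :=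
  (seq X₁ p.1, p.2)

/-- Per-letter mean square error of the reconstruction of `x₁ⁿ` by agent B. -/
def distortion₁ (M : Mechanism 𝒰 n K) (P : Measure Letter) : ℝ≥0∞ :=
  (∑ i, ∫⁻ p, ENNReal.ofReal ((X₁ (p.1 i) - M.g₁ (viewB p) i) ^ 2) ∂(M.law P)) / (n : ℝ≥0∞)

/-- Per-letter mean square error of the reconstruction of `x₂ⁿ` by agent A. -/
def distortion₂ (M : Mechanism 𝒰 n K) (P : Measure Letter) : ℝ≥0∞ :=
  (∑ i, ∫⁻ p, ENNReal.ofReal ((X₂ (p.1 i) - M.g₂ (viewA p) i) ^ 2) ∂(M.law P)) / (n : ℝ≥0∞)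

/-- Per-letter leakage `I(Y₁ⁿ; U₁ⁿ, …, U_Kⁿ, X₂ⁿ) / n` of the private data of A at B. -/
def leakage₁ (M : Mechanism 𝒰 n K) (P : Measure Letter) : ℝ≥0∞ :=
  mutualInfo (M.law P) (fun p => seq Y₁ p.1) viewB / (n : ℝ≥0∞)

/-- Per-letter leakage `I(Y₂ⁿ; U₁ⁿ, …, U_Kⁿ, X₁ⁿ) / n` of the private data of B at A. -/
def leakage₂ (M : Mechanism 𝒰 n K) (P : Measure Letter) : ℝ≥0∞ :=
  mutualInfo (M.law P) (fun p => seq Y₂ p.1) viewA / (n : ℝ≥0∞)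

end Mechanism

/-- A family of `K`-round mechanisms, one for each block length, meets the leakage levels
`L₁, L₂` and the distortion levels `D₁, D₂` asymptotically. -/
def Achieves {𝒰 : ℕ → Type} [∀ k, MeasurableSpace (𝒰 k)] {K : ℕ} (M : ∀ n, Mechanism 𝒰 n K)
    (P : Measure Letter) (L₁ L₂ D₁ D₂ : ℝ) : Prop :=
  ((limsup (fun n => (M n).distortion₁ P) atTop : ℝ≥0∞) : EReal) ≤ (D₁ : EReal) ∧
  ((limsup (fun n => (M n).distortion₂ P) atTop : ℝ≥0∞) : EReal) ≤ (D₂ : EReal) ∧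
  ((limsup (fun n => (M n).leakage₁ P) atTop : ℝ≥0∞) : EReal) ≤ (L₁ : EReal) ∧
  ((limsup (fun n => (M n).leakage₂ P) atTop : ℝ≥0∞) : EReal) ≤ (L₂ : EReal)

/-- `(L₁, L₂, D₁, D₂)` belongs to the leakage–distortion region of `K`-round interactive privacy
mechanisms (with arbitrary message alphabets) for the source `P`. -/
def Achievable (P : Measure Letter) (K : ℕ) (L₁ L₂ D₁ D₂ : ℝ) : Prop :=
  ∃ (𝒰 : ℕ → Type) (_ : ∀ k, MeasurableSpace (𝒰 k)) (M : ∀ n, Mechanism 𝒰 n K),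
    Achieves M P L₁ L₂ D₁ D₂

/-- The Gaussian test channel `u = x + v` with `v ∼ N(0, Q)`, as the law of `u` for a given `x`.
The value `Q = ∞` stands for the channel that reveals nothing. -/
def testChannel (Q : ℝ≥0∞) (x : ℝ) : Measure ℝ :=
  if Q = ∞ then Measure.dirac 0 else (gaussianReal 0 Q.toNNReal).map fun v => x + v

/-- A one-shot mechanism made of Gaussian test channels: each agent speaks once, without regard
to the message of the other, and adds independent Gaussian noise to each of its public letters,
`u₁ = x₁ + v₁` with `v₁ ∼ N(0, Q₁)` and `u₂ = x₂ + v₂` with `v₂ ∼ N(0, Q₂)`. -/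
def IsOneShotGaussian {n : ℕ} (M : Mechanism (fun _ => ℝ) n 2) (Q₁ Q₂ : ℝ≥0∞) : Prop :=
  (∀ x h, M.message 0 (x, h) = Measure.pi fun i => testChannel Q₁ (x i)) ∧
  (∀ x h, M.message 1 (x, h) = Measure.pi fun i => testChannel Q₂ (x i))

end PrivateInteraction

end

open PrivateInteraction

noncomputable section

namespace PrivateInteraction

/-! ### Gaussian likelihood ratios and mutual information -/

/-! Interaction cannot help, because the converse uses only one property of a mechanism: its
messages are generated from the public sequences alone. By regression, Y₁ = αX₁ + bX₂ + Z with Z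
independent of (X₁, X₂). Hence Zⁿ is independent of (X₁ⁿ, X₂ⁿ) together with the whole transcript,
whatever the number of rounds and the alphabets (`indepFun_compProd_comap`, `indepFun_seq_law`). If
agent B reconstructs X₁ⁿ with distortion at most D, then αX̂₁ + bX₂ estimates Y₁ⁿ from B's view with
per-letter error at most N = α²D + σ²(Z), since the cross term with Z vanishes.

An estimator of an i.i.d. Gaussian sequence forces information. In the variational lower bound for
the divergence, take as test function the log-ratio of the product of N(h(W)ᵢ, d) to the i.i.d. law
N(0, s) (`le_mutualInfo`). Per letter this gives at least (1/2) log(s/d) + 1/2 − N/(2d). The choice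
d = N yields (1/2) log(s/N), and N = 0 is incompatible with finite leakage
(`leakageBound_of_forall_le`). The minimum with σ²(X₁|X₂) appears because B can always use the
linear regression of X₁ on X₂ as a second estimator (`leakageBound_of_limsup_le`). Agent A is
treated symmetrically.

For achievability, let X₁ = cX₂ + R be the regression of X₁ on X₂, with residual variance σ. A
Gaussian test channel of noise variance Q with 1/D = 1/σ + 1/Q brings the linear estimation error of
R down to exactly D (`exists_testChannel`). By orthogonality and joint Gaussianity, the resulting
error in Y₁ is independent of B's entire view (`IsNoisyLetter.indepFun_estimationError`). The
variational bound is then an equality with d = N (`mutualInfo_eq_of_indepFun`). When D ≥ σ no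
message is needed, which is the channel Q = ∞. For K > 2 the remaining rounds carry the constant
message 0. -/

/-- The logarithm of the density of `N(m, d)` with respect to `N(0, s)`. -/
def gaussianLogRatio (s d : ℝ≥0) (m y : ℝ) : ℝ :=
  1 / 2 * Real.log (s / d) + y ^ 2 / (2 * s) - (y - m) ^ 2 / (2 * d)

theorem gaussianReal_eq_withDensity {s d : ℝ≥0} (hs : s ≠ 0) (hd : d ≠ 0) (m : ℝ) :
    gaussianReal m d = (gaussianReal 0 s).withDensity
      fun y => ENNReal.ofReal (Real.exp (gaussianLogRatio s d m y)) := by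
  have hm : Measurable fun y => ENNReal.ofReal (Real.exp (gaussianLogRatio s d m y)) := by
    unfold gaussianLogRatio
    fun_prop
  rw [gaussianReal_of_var_ne_zero m hd, gaussianReal_of_var_ne_zero 0 hs,
    ← withDensity_mul _ (measurable_gaussianPDF 0 s) hm]
  congr 1
  funext y
  have hs' : (0 : ℝ) < s := by positivity
  have hd' : (0 : ℝ) < d := by positivity
  simp only [Pi.mul_apply, gaussianPDF, gaussianPDFReal]
  rw [← ENNReal.ofReal_mul (by positivity)]
  congr 1
  have h1 : Real.exp (1 / 2 * Real.log (s / d)) = √(s / d) := by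
    rw [Real.sqrt_eq_rpow, Real.rpow_def_of_pos (by positivity)]
    ring_nf
  have h2 : Real.exp (gaussianLogRatio s d m y)
      = √(s / d) * Real.exp (y ^ 2 / (2 * s)) * Real.exp (-(y - m) ^ 2 / (2 * d)) := by
    rw [← h1, ← Real.exp_add, ← Real.exp_add, gaussianLogRatio]
    ring_nf
  have h3 : Real.exp (-(y - 0) ^ 2 / (2 * s)) * Real.exp (y ^ 2 / (2 * s)) = 1 := by
    rw [← Real.exp_add]
    ring_nf
    exact Real.exp_zero
  have h4 : (√(2 * Real.pi * d))⁻¹ = (√(2 * Real.pi * s))⁻¹ * √(s / d) := by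
    rw [Real.sqrt_div hs'.le, Real.sqrt_mul (by positivity) (d : ℝ),
      Real.sqrt_mul (by positivity) (s : ℝ)]
    field_simp
  rw [h2, h4]
  linear_combination (-(√(2 * Real.pi * s))⁻¹ * √(s / d) * Real.exp (-(y - m) ^ 2 / (2 * d))) * h3

/-- On a box, the integrand of the product density splits into functions of single coordinates.
These are independent under the product measure, so the integral factors, and boxes determine the
measure. -/
theorem pi_withDensity {n : ℕ} {μ : Fin n → Measure ℝ} [∀ i, IsProbabilityMeasure (μ i)]
    {f : Fin n → ℝ → ℝ≥0∞} (hf : ∀ i, Measurable (f i))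
    [∀ i, SigmaFinite ((μ i).withDensity (f i))] :
    Measure.pi (fun i => (μ i).withDensity (f i))
      = (Measure.pi μ).withDensity fun y => ∏ i, f i (y i) := by
  refine Measure.pi_eq fun t ht => ?_
  rw [withDensity_apply _ (MeasurableSet.univ_pi ht),
    ← lintegral_indicator (MeasurableSet.univ_pi ht)]
  have h : (Set.univ.pi t).indicator (fun y => ∏ i, f i (y i))
      = fun y => ∏ i, (t i).indicator (f i) (y i) := by
    funext y
    by_cases hy : y ∈ Set.univ.pi t
    · rw [Set.indicator_of_mem hy]
      refine Finset.prod_congr rfl fun i _ => ?_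
      rw [Set.indicator_of_mem (hy i (Set.mem_univ i))]
    · rw [Set.indicator_of_notMem hy]
      simp only [Set.mem_pi, Set.mem_univ, true_implies, not_forall] at hy
      obtain ⟨i, hi⟩ := hy
      exact (Finset.prod_eq_zero (Finset.mem_univ i) (Set.indicator_of_notMem hi _)).symm
  rw [h]
  have hind : iIndepFun (fun i (y : Fin n → ℝ) => (t i).indicator (f i) (y i)) (Measure.pi μ) :=
    iIndepFun_pi fun i => ((hf i).indicator (ht i)).aemeasurable
  have := lintegral_prod_eq_prod_lintegral_of_indepFun Finset.univ
    (fun i (y : Fin n → ℝ) => (t i).indicator (f i) (y i)) hind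
    fun i => ((hf i).indicator (ht i)).comp (measurable_pi_apply i)
  rw [this]
  refine Finset.prod_congr rfl fun i _ => ?_
  rw [withDensity_apply _ (ht i), ← lintegral_indicator (ht i)]
  have hmp := measurePreserving_eval μ i
  conv_rhs => rw [← hmp.map_eq, lintegral_map ((hf i).indicator (ht i)) (measurable_pi_apply i)]

/-- The logarithm of the density of a product of Gaussian laws with means `m i` and common variance
`d` with respect to the i.i.d. centered Gaussian law of variance `s`. -/
def gaussianLogRatioPi {n : ℕ} (s d : ℝ≥0) (m y : Fin n → ℝ) : ℝ :=
  ∑ i, gaussianLogRatio s d (m i) (y i)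

theorem pi_gaussianReal_eq_withDensity {n : ℕ} {s d : ℝ≥0} (hs : s ≠ 0) (hd : d ≠ 0)
    (m : Fin n → ℝ) :
    Measure.pi (fun i => gaussianReal (m i) d) = (Measure.pi fun _ => gaussianReal 0 s).withDensity
      fun y => ENNReal.ofReal (Real.exp (gaussianLogRatioPi s d m y)) := by
  have h := fun i => gaussianReal_eq_withDensity hs hd (m i)
  have hσ : ∀ i, SigmaFinite ((gaussianReal 0 s).withDensity
      fun y => ENNReal.ofReal (Real.exp (gaussianLogRatio s d (m i) y))) := by
    intro i
    rw [← h i]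
    infer_instance
  simp_rw [h]
  rw [pi_withDensity fun i => by unfold gaussianLogRatio; fun_prop]
  congr 1
  funext y
  rw [gaussianLogRatioPi, Real.exp_sum, ENNReal.ofReal_prod_of_nonneg]
  exact fun i _ => (Real.exp_pos _).le

theorem gaussianLogRatioPi_eq {n : ℕ} {s d : ℝ≥0} (y m : Fin n → ℝ) :
    gaussianLogRatioPi s d m y = n * (1 / 2 * Real.log (s / d)) + (∑ i, y i ^ 2) / (2 * s)
      - (∑ i, (y i - m i) ^ 2) / (2 * d) := by
  simp only [gaussianLogRatioPi, gaussianLogRatio, Finset.sum_sub_distrib, Finset.sum_add_distrib,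
    Finset.sum_div, Finset.sum_const, Finset.card_univ, Fintype.card_fin, nsmul_eq_mul]

theorem integrable_gaussianLogRatioPi {Ω : Type} [MeasurableSpace Ω] {μ : Measure Ω}
    [IsProbabilityMeasure μ] {n : ℕ} {Y m : Ω → Fin n → ℝ} {s d : ℝ≥0}
    (hY : ∀ i, MemLp (fun ω => Y ω i) 2 μ)
    (hZ : ∀ i, MemLp (fun ω => Y ω i - m ω i) 2 μ) :
    Integrable (fun ω => gaussianLogRatioPi s d (m ω) (Y ω)) μ := by
  simp only [gaussianLogRatioPi_eq]
  refine Integrable.sub (Integrable.add (integrable_const _) ?_) ?_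
  · exact (integrable_finsetSum _ fun i _ => (hY i).integrable_sq).div_const _
  · exact (integrable_finsetSum _ fun i _ => (hZ i).integrable_sq).div_const _

theorem integral_gaussianLogRatioPi {Ω : Type} [MeasurableSpace Ω] {μ : Measure Ω}
    [IsProbabilityMeasure μ] {n : ℕ} {Y m : Ω → Fin n → ℝ} {s d : ℝ≥0}
    (hY : ∀ i, MemLp (fun ω => Y ω i) 2 μ)
    (hZ : ∀ i, MemLp (fun ω => Y ω i - m ω i) 2 μ) :
    ∫ ω, gaussianLogRatioPi s d (m ω) (Y ω) ∂μ = n * (1 / 2 * Real.log (s / d))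
      + (∑ i, ∫ ω, Y ω i ^ 2 ∂μ) / (2 * s)
      - (∑ i, ∫ ω, (Y ω i - m ω i) ^ 2 ∂μ) / (2 * d) := by
  have h1 : Integrable (fun ω => (∑ i, Y ω i ^ 2) / (2 * s)) μ :=
    (integrable_finsetSum _ fun i _ => (hY i).integrable_sq).div_const _
  have h2 : Integrable (fun ω => (∑ i, (Y ω i - m ω i) ^ 2) / (2 * d)) μ :=
    (integrable_finsetSum _ fun i _ => (hZ i).integrable_sq).div_const _
  have h3 : Integrable (fun ω => n * (1 / 2 * Real.log (s / d)) + (∑ i, Y ω i ^ 2) / (2 * s)) μ :=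
    (integrable_const _).add h1
  simp only [gaussianLogRatioPi_eq]
  rw [integral_sub h3 h2, integral_add (integrable_const _) h1, integral_div, integral_div,
    integral_finsetSum _ fun i _ => (hY i).integrable_sq,
    integral_finsetSum _ fun i _ => (hZ i).integrable_sq]
  simp

theorem memLp_and_integral_sq_of_map_eq {Ω : Type} [MeasurableSpace Ω] {μ : Measure Ω} {n : ℕ}
    {Y : Ω → Fin n → ℝ} {s : ℝ≥0} (hYm : Measurable Y)
    (hYlaw : μ.map Y = Measure.pi fun _ => gaussianReal 0 s) (i : Fin n) :
    MemLp (fun ω => Y ω i) 2 μ ∧ ∫ ω, Y ω i ^ 2 ∂μ = s := by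
  have hYi : Measurable fun ω => Y ω i := (measurable_pi_apply i).comp hYm
  have hlaw : μ.map (fun ω => Y ω i) = gaussianReal 0 s := by
    have := (measurePreserving_eval (fun _ : Fin n => gaussianReal 0 s) i).map_eq
    rw [← hYlaw, Measure.map_map (measurable_pi_apply i) hYm] at this
    exact this
  have hG : HasGaussianLaw (fun ω => Y ω i) μ := ⟨by rw [hlaw]; infer_instance⟩
  refine ⟨hG.memLp_two, ?_⟩
  have hv := variance_id_gaussianReal (μ := 0) (v := s)
  rw [variance_of_integral_eq_zero aemeasurable_id (by simp), ← hlaw,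
    integral_map hYi.aemeasurable (by fun_prop)] at hv
  exact hv

/-! ### Gaussian lower bound and exact value for mutual information -/

section MutualInformation

variable {Ω β : Type} [MeasurableSpace Ω] [MeasurableSpace β] {μ : Measure Ω}
  [IsProbabilityMeasure μ] {n : ℕ} {Y : Ω → Fin n → ℝ} {W : Ω → β} {h : β → Fin n → ℝ} {s d : ℝ≥0}

/-- The test function in the variational formula for mutual information. -/
def logRatioAt (s d : ℝ≥0) (h : β → Fin n → ℝ) (p : (Fin n → ℝ) × β) : ℝ :=
  gaussianLogRatioPi s d (h p.2) p.1

theorem measurable_logRatioAt (hh : Measurable h) : Measurable (logRatioAt s d h) := by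
  have h1 : ∀ i, Measurable fun p : (Fin n → ℝ) × β => p.1 i := fun i =>
    (measurable_pi_apply i).comp measurable_fst
  have h2 : ∀ i, Measurable fun p : (Fin n → ℝ) × β => h p.2 i := fun i =>
    (measurable_pi_apply i).comp (hh.comp measurable_snd)
  have : logRatioAt s d h = fun p : (Fin n → ℝ) × β => n * (1 / 2 * Real.log (s / d))
      + (∑ i, p.1 i ^ 2) / (2 * s) - (∑ i, (p.1 i - h p.2 i) ^ 2) / (2 * d) :=
    funext fun p => gaussianLogRatioPi_eq _ _
  rw [this]
  exact (((Finset.measurable_fun_sum _ fun i _ => (h1 i).pow_const 2).div_const _).const_add _).sub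
    ((Finset.measurable_fun_sum _ fun i _ => ((h1 i).sub (h2 i)).pow_const 2).div_const _)

/-- Reweighting turns the independent pair into the Gaussian channel w ↦ N(h(w), d). With g = 1 this
is the normalisation needed by the variational bound; with arbitrary g it identifies the joint law
in the case of equality. -/
theorem lintegral_exp_logRatioAt (hs : s ≠ 0) (hd : d ≠ 0) (hh : Measurable h) (ρ : Measure β)
    [SFinite ρ] {g : (Fin n → ℝ) × β → ℝ≥0∞} (hg : Measurable g) :
    ∫⁻ p, ENNReal.ofReal (Real.exp (logRatioAt s d h p)) * g p
        ∂((Measure.pi fun _ : Fin n => gaussianReal 0 s).prod ρ)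
      = ∫⁻ w, ∫⁻ y, g (y, w) ∂(Measure.pi fun i => gaussianReal (h w i) d) ∂ρ := by
  have hm : Measurable fun p => ENNReal.ofReal (Real.exp (logRatioAt s d h p)) :=
    (measurable_logRatioAt hh).exp.ennreal_ofReal
  refine (lintegral_prod_symm _ (hm.mul hg).aemeasurable).trans ?_
  refine lintegral_congr fun w => ?_
  have hw : Measurable fun y : Fin n → ℝ => (y, w) := measurable_id.prodMk measurable_const
  have hmw : Measurable fun y => ENNReal.ofReal (Real.exp (gaussianLogRatioPi s d (h w) y)) := by
    simpa only [Function.comp_def, logRatioAt] using hm.comp hw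
  have hgw : Measurable fun y => g (y, w) := hg.comp hw
  rw [pi_gaussianReal_eq_withDensity hs hd, lintegral_withDensity_eq_lintegral_mul _ hmw hgw]
  simp only [Pi.mul_apply, logRatioAt]

/-- A lower bound on the information that `W` carries about an i.i.d. Gaussian sequence `Y`, from
the mean square error of an estimator of `Y` based on `W`. -/
theorem le_mutualInfo (hs : s ≠ 0) (hd : d ≠ 0) (hYm : Measurable Y) (hWm : Measurable W)
    (hYlaw : μ.map Y = Measure.pi fun _ => gaussianReal 0 s) (hh : Measurable h)
    (hZ : ∀ i, MemLp (fun ω => Y ω i - h (W ω) i) 2 μ) :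
    ENNReal.ofReal (n * (1 / 2 * Real.log (s / d)) + n / 2
      - (∑ i, ∫ ω, (Y ω i - h (W ω) i) ^ 2 ∂μ) / (2 * d)) ≤ mutualInfo μ Y W := by
  by_cases htop : mutualInfo μ Y W = ∞
  · rw [htop]; exact le_top
  have hWprob := Measure.isProbabilityMeasure_map (μ := μ) hWm.aemeasurable
  have hJprob := Measure.isProbabilityMeasure_map (μ := μ) (hYm.prodMk hWm).aemeasurable
  have hm := measurable_logRatioAt (s := s) (d := d) hh
  unfold mutualInfo at htop ⊢
  rw [hYlaw] at htop ⊢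
  obtain ⟨hac, hint⟩ := InformationTheory.klDiv_ne_top_iff.1 htop
  set π := (Measure.pi fun _ : Fin n => gaussianReal 0 s).prod (μ.map W) with hπ
  set J := μ.map fun ω => (Y ω, W ω) with hJ
  have hY := fun i => memLp_and_integral_sq_of_map_eq hYm hYlaw i
  have hfJ : Integrable (logRatioAt s d h) J :=
    (integrable_map_measure hm.aestronglyMeasurable (hYm.prodMk hWm).aemeasurable).2
      (integrable_gaussianLogRatioPi (fun i => (hY i).1) hZ)
  -- For each w the exponential is a probability density in y, so the log-normaliser of the tilted
  -- measure is 0.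
  have hlint : ∫⁻ p, ENNReal.ofReal (Real.exp (logRatioAt s d h p)) ∂π = 1 := by
    have := lintegral_exp_logRatioAt (g := fun _ => 1) hs hd hh (μ.map W) measurable_const
    simpa using this
  have hexp : Integrable (fun p => Real.exp (logRatioAt s d h p)) π := by
    refine ⟨hm.exp.aestronglyMeasurable, ?_⟩
    rw [hasFiniteIntegral_iff_ofReal (ae_of_all _ fun _ => (Real.exp_pos _).le), hlint]
    exact ENNReal.one_lt_top
  have hexp1 : ∫ p, Real.exp (logRatioAt s d h p) ∂π = 1 := by
    rw [integral_eq_lintegral_of_nonneg_ae (ae_of_all _ fun _ => (Real.exp_pos _).le)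
      hm.exp.aestronglyMeasurable, hlint]
    simp
  -- The divergence of `J` from the tilted measure is the mutual information minus the mean of the
  -- test function under `J`. Its nonnegativity is the variational bound.
  have htilt := integral_llr_tilted_right hac hfJ hexp hint
  rw [hexp1, Real.log_one, add_zero] at htilt
  have hprob : IsProbabilityMeasure (π.tilted (logRatioAt s d h)) := isProbabilityMeasure_tilted hexp
  have hnonneg := InformationTheory.integral_llr_add_sub_measure_univ_nonneg
    (hac.trans (absolutelyContinuous_tilted hexp)) (integrable_llr_tilted_right hac hfJ hint hexp)
  rw [InformationTheory.klDiv_of_ac_of_integrable hac hint]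
  refine ENNReal.ofReal_le_ofReal ?_
  simp only [probReal_univ, add_sub_cancel_right] at hnonneg ⊢
  have hval : ∫ p, logRatioAt s d h p ∂J = _ :=
    (integral_map (hYm.prodMk hWm).aemeasurable hm.aestronglyMeasurable).trans
      (integral_gaussianLogRatioPi (fun i => (hY i).1) hZ)
  have hsum : (∑ i, ∫ ω, Y ω i ^ 2 ∂μ) / (2 * s) = (n : ℝ) / 2 := by
    simp only [fun i => (hY i).2, Finset.sum_const, Finset.card_univ, Fintype.card_fin,
      nsmul_eq_mul]
    have : (s : ℝ) ≠ 0 := by simpa using hs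
    field_simp
  rw [hsum] at hval
  linarith

/-- If an i.i.d. Gaussian sequence `Y` is the sum of a function of `W` and of i.i.d. Gaussian noise
that is independent of `W`, the mutual information is that of the Gaussian channel. -/
theorem mutualInfo_eq_of_indepFun (hs : s ≠ 0) (hd : d ≠ 0) (hYm : Measurable Y)
    (hWm : Measurable W) (hYlaw : μ.map Y = Measure.pi fun _ => gaussianReal 0 s)
    (hh : Measurable h)
    (hZlaw : μ.map (fun ω => Y ω - h (W ω)) = Measure.pi fun _ => gaussianReal 0 d)
    (hind : IndepFun (fun ω => Y ω - h (W ω)) W μ) :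
    mutualInfo μ Y W = ENNReal.ofReal (n * (1 / 2 * Real.log (s / d))) := by
  have hWprob := Measure.isProbabilityMeasure_map (μ := μ) hWm.aemeasurable
  have hJprob := Measure.isProbabilityMeasure_map (μ := μ) (hYm.prodMk hWm).aemeasurable
  have hm := measurable_logRatioAt (s := s) (d := d) hh
  have hZm : Measurable fun ω => Y ω - h (W ω) := hYm.sub (hh.comp hWm)
  set π := (Measure.pi fun _ : Fin n => gaussianReal 0 s).prod (μ.map W) with hπ
  have hshift : ∀ m : Fin n → ℝ, (Measure.pi fun i => gaussianReal (m i) d)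
      = (Measure.pi fun _ => gaussianReal 0 d).map fun z => z + m := by
    intro m
    have := Measure.pi_map_pi (μ := fun _ : Fin n => gaussianReal 0 d)
      (f := fun i z => z + m i) (fun i => by fun_prop)
    simp only [gaussianReal_map_add_const, zero_add] at this
    exact this.symm
  -- In the coordinates (Y − h(W), W) the joint law is a product; shifting back by h(w) gives the
  -- Gaussian channel, which is the reweighted product.
  have hJ : μ.map (fun ω => (Y ω, W ω))
      = π.withDensity fun p => ENNReal.ofReal (Real.exp (logRatioAt s d h p)) := by
    refine Measure.ext_of_lintegral _ fun g hg => ?_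
    rw [lintegral_withDensity_eq_lintegral_mul _ hm.exp.ennreal_ofReal hg]
    refine Eq.trans ?_ (lintegral_exp_logRatioAt hs hd hh (μ.map W) hg).symm
    have hpair := (indepFun_iff_map_prod_eq_prod_map_map hZm.aemeasurable hWm.aemeasurable).1 hind
    have hg' : Measurable fun q : (Fin n → ℝ) × β => g (q.1 + h q.2, q.2) :=
      hg.comp ((measurable_fst.add (hh.comp measurable_snd)).prodMk measurable_snd)
    have h1 : ∫⁻ p, g p ∂(μ.map fun ω => (Y ω, W ω))
        = ∫⁻ q, g (q.1 + h q.2, q.2) ∂(μ.map fun ω => (Y ω - h (W ω), W ω)) := by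
      rw [lintegral_map hg (hYm.prodMk hWm), lintegral_map hg' (hZm.prodMk hWm)]
      simp
    rw [h1, hpair, hZlaw, lintegral_prod_symm _ hg'.aemeasurable]
    refine lintegral_congr fun w => ?_
    rw [hshift (h w), lintegral_map (f := fun y => g (y, w))
      (hg.comp (measurable_id.prodMk measurable_const)) (by fun_prop)]
  have hac : μ.map (fun ω => (Y ω, W ω)) ≪ π := hJ ▸ withDensity_absolutelyContinuous _ _
  have hllr : llr (μ.map fun ω => (Y ω, W ω)) π =ᵐ[μ.map fun ω => (Y ω, W ω)]
      logRatioAt s d h := by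
    refine hac.ae_le ?_
    have := Measure.rnDeriv_withDensity π
      (f := fun p => ENNReal.ofReal (Real.exp (logRatioAt s d h p))) hm.exp.ennreal_ofReal
    rw [← hJ] at this
    filter_upwards [this] with p hp
    rw [llr, hp, ENNReal.toReal_ofReal (Real.exp_pos _).le, Real.log_exp]
  have hY := fun i => memLp_and_integral_sq_of_map_eq hYm hYlaw i
  have hZ := fun i => memLp_and_integral_sq_of_map_eq hZm hZlaw i
  have hint : Integrable (logRatioAt s d h) (μ.map fun ω => (Y ω, W ω)) :=
    (integrable_map_measure hm.aestronglyMeasurable (hYm.prodMk hWm).aemeasurable).2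
      (integrable_gaussianLogRatioPi (fun i => (hY i).1) fun i => (hZ i).1)
  rw [mutualInfo, hYlaw, InformationTheory.klDiv_of_ac_of_integrable hac (hint.congr hllr.symm),
    integral_congr_ae hllr, integral_map (hYm.prodMk hWm).aemeasurable hm.aestronglyMeasurable]
  simp only [logRatioAt]
  rw [integral_gaussianLogRatioPi (m := fun ω => h (W ω)) (fun i => (hY i).1) fun i => (hZ i).1]
  congr 1
  have hs' : (s : ℝ) ≠ 0 := by simpa using hs
  have hd' : (d : ℝ) ≠ 0 := by simpa using hd
  have hZ2 : ∀ i, ∫ ω, (Y ω i - h (W ω) i) ^ 2 ∂μ = d := fun i => (hZ i).2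
  simp only [fun i => (hY i).2, hZ2, Finset.sum_const, Finset.card_univ, Fintype.card_fin,
    nsmul_eq_mul, probReal_univ]
  -- The noise has second moment exactly d, so the terms s/(2s) and d/(2d) cancel.
  field_simp
  ring

end MutualInformation

/-! ### Independence -/

section Independence

variable {Ω : Type} [MeasurableSpace Ω] {μ : Measure Ω}

/-- For a jointly Gaussian pair of vectors it suffices that every linear functional of one is
uncorrelated with every linear functional of the other. By bilinearity only the coordinates need
checking. -/
theorem indepFun_prodMk_of_covariance_eq_zero {Z U V : Ω → ℝ}
    (h : HasGaussianLaw (fun ω => (Z ω, U ω, V ω)) μ) (hU : cov[Z, U; μ] = 0)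
    (hV : cov[Z, V; μ] = 0) : IndepFun Z (fun ω => (U ω, V ω)) μ := by
  have := h.isProbabilityMeasure
  have hZ := h.fst.memLp_two
  have hU2 := h.snd.fst.memLp_two
  have hV2 := h.snd.snd.memLp_two
  refine h.indepFun_of_covariance_strongDual fun L₁ L₂ => ?_
  have h1 : L₁ ∘ Z = fun ω => L₁ 1 * Z ω := by
    funext ω
    have := L₁.map_smul (Z ω) 1
    simp only [smul_eq_mul, mul_one] at this
    simp only [Function.comp_apply, this]
    ring
  have h2 : (L₂ ∘ fun ω => (U ω, V ω))
      = (fun ω => L₂ (1, 0) * U ω) + fun ω => L₂ (0, 1) * V ω := by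
    funext ω
    have e : (U ω, V ω) = U ω • ((1 : ℝ), (0 : ℝ)) + V ω • ((0 : ℝ), (1 : ℝ)) := by simp
    simp only [Function.comp_apply, Pi.add_apply]
    rw [e, map_add, map_smul, map_smul, smul_eq_mul, smul_eq_mul]
    ring
  rw [h1, h2, covariance_add_right (hZ.const_mul _) (hU2.const_mul _) (hV2.const_mul _),
    covariance_const_mul_left, covariance_const_mul_left, covariance_const_mul_right,
    covariance_const_mul_right, hU, hV]
  simp

theorem indepFun_prodMk_prodMk_of_covariance_eq_zero {Z U V T : Ω → ℝ}
    (h : HasGaussianLaw (fun ω => (Z ω, U ω, V ω, T ω)) μ) (hU : cov[Z, U; μ] = 0)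
    (hV : cov[Z, V; μ] = 0) (hT : cov[Z, T; μ] = 0) :
    IndepFun Z (fun ω => (U ω, V ω, T ω)) μ := by
  have := h.isProbabilityMeasure
  have hZ := h.fst.memLp_two
  have hU2 := h.snd.fst.memLp_two
  have hV2 := h.snd.snd.fst.memLp_two
  have hT2 := h.snd.snd.snd.memLp_two
  refine h.indepFun_of_covariance_strongDual fun L₁ L₂ => ?_
  have h1 : L₁ ∘ Z = fun ω => L₁ 1 * Z ω := by
    funext ω
    have := L₁.map_smul (Z ω) 1
    simp only [smul_eq_mul, mul_one] at this
    simp only [Function.comp_apply, this]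
    ring
  have h2 : (L₂ ∘ fun ω => (U ω, V ω, T ω)) = (fun ω => L₂ (1, 0, 0) * U ω)
      + ((fun ω => L₂ (0, 1, 0) * V ω) + fun ω => L₂ (0, 0, 1) * T ω) := by
    funext ω
    have e : (U ω, V ω, T ω) = U ω • ((1 : ℝ), (0 : ℝ), (0 : ℝ))
        + (V ω • ((0 : ℝ), (1 : ℝ), (0 : ℝ)) + T ω • ((0 : ℝ), (0 : ℝ), (1 : ℝ))) := by simp
    simp only [Function.comp_apply, Pi.add_apply]
    rw [e, map_add, map_add, map_smul, map_smul, map_smul, smul_eq_mul, smul_eq_mul, smul_eq_mul]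
    ring
  rw [h1, h2, covariance_add_right (hZ.const_mul _) (hU2.const_mul _)
      ((hV2.const_mul _).add (hT2.const_mul _)),
    covariance_add_right (hZ.const_mul _) (hV2.const_mul _) (hT2.const_mul _)]
  simp only [covariance_const_mul_left, covariance_const_mul_right, hU, hV, hT]
  simp

/-- The kernel sees ω only through π(ω), so given π the output carries no further information about
Z. On rectangles, the measure is the integral of an indicator in Z times a function of π, which
factors. -/
theorem indepFun_compProd_comap {S γ β : Type} [MeasurableSpace S] [MeasurableSpace γ]
    [MeasurableSpace β] [IsProbabilityMeasure μ] {π : Ω → S} (hπ : Measurable π) (κ : Kernel S β)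
    [IsMarkovKernel κ] {Z : Ω → γ} (hZ : Measurable Z) (h : IndepFun Z π μ) :
    IndepFun (fun p : Ω × β => Z p.1) (fun p => (π p.1, p.2))
      (μ.compProd (κ.comap π hπ)) := by
  have hW : Measurable fun p : Ω × β => (π p.1, p.2) := by fun_prop
  have hZ' : Measurable fun p : Ω × β => Z p.1 := by fun_prop
  rw [indepFun_iff_measure_inter_preimage_eq_mul]
  intro A B hA hB
  have hκ : Measurable fun x => κ x (Prod.mk x ⁻¹' B) := Kernel.measurable_kernel_prodMk_left hB
  rw [Measure.compProd_apply ((hZ' hA).inter (hW hB)), Measure.compProd_apply (hZ' hA),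
    Measure.compProd_apply (hW hB)]
  have h1 : ∀ ω, (κ.comap π hπ) ω (Prod.mk ω ⁻¹'
      ((fun p : Ω × β => Z p.1) ⁻¹' A ∩ (fun p => (π p.1, p.2)) ⁻¹' B))
      = A.indicator 1 (Z ω) * κ (π ω) (Prod.mk (π ω) ⁻¹' B) := by
    intro ω
    rw [Kernel.comap_apply]
    by_cases hω : Z ω ∈ A
    · rw [Set.indicator_of_mem hω, Pi.one_apply, one_mul]
      congr 1
      ext t
      simp [hω]
    · rw [Set.indicator_of_notMem hω, zero_mul]
      convert measure_empty (μ := κ (π ω))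
      ext t
      simp [hω]
  have h2 : ∀ ω, (κ.comap π hπ) ω (Prod.mk ω ⁻¹' ((fun p : Ω × β => Z p.1) ⁻¹' A))
      = A.indicator 1 (Z ω) := by
    intro ω
    rw [Kernel.comap_apply]
    by_cases hω : Z ω ∈ A
    · rw [Set.indicator_of_mem hω, Pi.one_apply]
      convert measure_univ (μ := κ (π ω))
      ext t
      simp [hω]
    · rw [Set.indicator_of_notMem hω]
      convert measure_empty (μ := κ (π ω))
      ext t
      simp [hω]
  have h3 : ∀ ω, (κ.comap π hπ) ω (Prod.mk ω ⁻¹' ((fun p : Ω × β => (π p.1, p.2)) ⁻¹' B))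
      = κ (π ω) (Prod.mk (π ω) ⁻¹' B) := fun ω => by
    rw [Kernel.comap_apply]
    rfl
  simp only [h1, h2, h3]
  have hAm : Measurable (A.indicator (1 : γ → ℝ≥0∞)) := measurable_one.indicator hA
  exact lintegral_mul_eq_lintegral_mul_lintegral_of_indepFun (hAm.comp hZ) (hκ.comp hπ)
    (h.comp hAm hκ)

/-- Both sides come from the i.i.d. law of the pairs (u, v): a product of product measures
rearranges into the product of the two sequence laws. -/
theorem indepFun_pi {α β γ : Type} [MeasurableSpace α] [MeasurableSpace β] [MeasurableSpace γ]
    {ρ : Measure α} [IsProbabilityMeasure ρ] {u : α → β} {v : α → γ} (hu : Measurable u)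
    (hv : Measurable v) (h : IndepFun u v ρ) (n : ℕ) :
    IndepFun (fun (s : Fin n → α) i => u (s i)) (fun s i => v (s i))
      (Measure.pi fun _ : Fin n => ρ) := by
  have hu' : Measurable fun (s : Fin n → α) i => u (s i) := by fun_prop
  have hv' : Measurable fun (s : Fin n → α) i => v (s i) := by fun_prop
  have := Measure.isProbabilityMeasure_map (μ := ρ) hu.aemeasurable
  have := Measure.isProbabilityMeasure_map (μ := ρ) hv.aemeasurable
  have := Measure.isProbabilityMeasure_map (μ := ρ) (hu.prodMk hv).aemeasurable
  rw [indepFun_iff_map_prod_eq_prod_map_map hu'.aemeasurable hv'.aemeasurable,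
    Measure.pi_map_pi fun _ => hu.aemeasurable, Measure.pi_map_pi fun _ => hv.aemeasurable,
    ← (measurePreserving_arrowProdEquivProdArrow β γ (Fin n) (fun _ => ρ.map u)
      (fun _ => ρ.map v)).map_eq]
  simp only [← (indepFun_iff_map_prod_eq_prod_map_map hu.aemeasurable hv.aemeasurable).1 h]
  rw [← Measure.pi_map_pi fun _ => (hu.prodMk hv).aemeasurable,
    Measure.map_map (MeasurableEquiv.measurable _) (by fun_prop)]
  rfl

end Independence

/-! ### Regression for a Gaussian letter -/

section Regression

variable {P : Measure Letter} {f g f' : Letter → ℝ}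

/-- The residual is centered and independent of W, so the conditional expectation of f is h(W) and
the conditional error is the residual itself. -/
theorem meanCondVar_eq_of_indepFun {β : Type} [MeasurableSpace β] [IsProbabilityMeasure P]
    {W : Letter → β} (hW : Measurable W) {h : β → ℝ} (hh : Measurable h) {r : Letter → ℝ}
    (hr : Measurable r) (hf : ∀ s, f s = h (W s) + r s) (hind : IndepFun r W P)
    (hhint : Integrable (fun s => h (W s)) P) (hrint : Integrable r P) (hr0 : ∫ s, r s ∂P = 0) :
    meanCondVar P f W = ∫ s, r s ^ 2 ∂P := by
  have hm : MeasurableSpace.comap W inferInstance ≤ (inferInstance : MeasurableSpace Letter) :=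
    hW.comap_le
  have hf' : f = (fun s => h (W s)) + r := funext hf
  have h1 : P[fun s => h (W s) | MeasurableSpace.comap W inferInstance] = fun s => h (W s) :=
    condExp_of_stronglyMeasurable hm (hh.comp (comap_measurable W)).stronglyMeasurable hhint
  have h2 : P[r | MeasurableSpace.comap W inferInstance] =ᵐ[P] fun _ => ∫ s, r s ∂P :=
    condExp_indep_eq hr.comap_le hm (comap_measurable r).stronglyMeasurable hind
  have h3 : P[f | MeasurableSpace.comap W inferInstance] =ᵐ[P] fun s => h (W s) := by
    rw [hf']
    filter_upwards [condExp_add hhint hrint (MeasurableSpace.comap W inferInstance), h2]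
      with s hs hs2
    rw [hs, Pi.add_apply, h1, hs2, hr0, add_zero]
  rw [meanCondVar, condVar, integral_condExp hm]
  refine integral_congr_ae ?_
  filter_upwards [h3] with s hs
  simp only [Pi.pow_apply, Pi.sub_apply, hs, hf]
  ring

/-- Linear regression data for a Gaussian triple `(g, f, f')`: residuals `z` of `g` on `(f, f')` and
`r` of `f` on `f'`, which are independent of their regressors. -/
structure IsRegression (P : Measure Letter) (g f f' : Letter → ℝ) (a b c : ℝ)
    (z r : Letter → ℝ) : Prop where
  measurable_f : Measurable f
  measurable_f' : Measurable f'
  measurable_z : Measurable z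
  measurable_r : Measurable r
  eq_g : ∀ s, g s = a * f s + b * f' s + z s
  eq_f : ∀ s, f s = c * f' s + r s
  gaussian : HasGaussianLaw (fun s => (z s, r s, f' s)) P
  indep_z : IndepFun z (fun s => (f s, f' s)) P
  indep_r : IndepFun r f' P
  mean_z : ∫ s, z s ∂P = 0
  mean_r : ∫ s, r s ∂P = 0
  mean_f' : ∫ s, f' s ∂P = 0
  condVar_g : meanCondVar P g (fun s => (f s, f' s)) = ∫ s, z s ^ 2 ∂P
  condVar_f : meanCondVar P f f' = ∫ s, r s ^ 2 ∂P

/-- Uncorrelated residuals of a Gaussian vector are independent of the regressors. Nothing requires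
`a` to be the only coefficient, so degenerate covariance matrices are allowed. -/
theorem exists_isRegression {a : ℝ} (hg : Measurable g) (hf : Measurable f) (hf' : Measurable f')
    (hG : HasGaussianLaw (fun s => (g s, f s, f' s)) P) (hg0 : ∫ s, g s ∂P = 0)
    (hf0 : ∫ s, f s ∂P = 0) (hf'0 : ∫ s, f' s ∂P = 0) (ha : IsRegressionCoeff P g f f' a) :
    ∃ b c z r, IsRegression P g f f' a b c z r := by
  obtain ⟨b, hb1, hb2⟩ := ha
  have := hG.isProbabilityMeasure
  have hg2 := hG.fst.memLp_two
  have hf2 := hG.snd.fst.memLp_two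
  have hf'2 := hG.snd.snd.memLp_two
  have hgi := hg2.integrable (by norm_num)
  have hfi := hf2.integrable (by norm_num)
  have hf'i := hf'2.integrable (by norm_num)
  obtain ⟨c, hc⟩ : ∃ c : ℝ, cov[fun s => f s - c * f' s, f'; P] = 0 := by
    have key : ∀ c : ℝ, cov[fun s => f s - c * f' s, f'; P] = cov[f, f'; P] - c * Var[f'; P] := by
      intro c
      rw [covariance_fun_sub_left hf2 (hf'2.const_mul c) hf'2, covariance_const_mul_left,
        covariance_self hf'.aemeasurable]
    -- If f' has variance 0 it vanishes almost surely, being centered, and any slope works;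
    -- otherwise c is the usual quotient of covariance by variance.
    by_cases hv : Var[f'; P] = 0
    · refine ⟨0, ?_⟩
      rw [key, zero_mul, sub_zero]
      rw [variance_of_integral_eq_zero hf'.aemeasurable hf'0,
        integral_eq_zero_iff_of_nonneg (fun s => sq_nonneg _) hf'2.integrable_sq] at hv
      have : cov[f, f'; P] = ∫ s, (f s - P[f]) * (f' s - P[f']) ∂P := rfl
      rw [this, integral_congr_ae (g := fun _ => 0), integral_zero]
      filter_upwards [hv] with s hs
      have hs' : f' s = 0 := by simpa using hs
      rw [hf'0, hs']
      simp
    · refine ⟨cov[f, f'; P] / Var[f'; P], ?_⟩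
      rw [key, div_mul_cancel₀ _ hv, sub_self]
  let Lz : ℝ × ℝ × ℝ →L[ℝ] ℝ × ℝ × ℝ := LinearMap.toContinuousLinearMap
    { toFun := fun p => (p.1 - a * p.2.1 - b * p.2.2, p.2.1, p.2.2)
      map_add' := fun p q => by ext <;> simp; ring
      map_smul' := fun t p => by ext <;> simp; ring }
  let Lr : ℝ × ℝ × ℝ →L[ℝ] ℝ × ℝ × ℝ := LinearMap.toContinuousLinearMap
    { toFun := fun p => (p.1, p.2.1 - c * p.2.2, p.2.2)
      map_add' := fun p q => by ext <;> simp; ring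
      map_smul' := fun t p => by ext <;> simp; ring }
  have hGz : HasGaussianLaw (fun s => (g s - a * f s - b * f' s, f s, f' s)) P := hG.map_fun Lz
  have hGr : HasGaussianLaw (fun s => (g s - a * f s - b * f' s, f s - c * f' s, f' s)) P :=
    hGz.map_fun Lr
  have hzind := indepFun_prodMk_of_covariance_eq_zero hGz hb1 hb2
  have hrind := hGr.snd.indepFun_of_covariance_eq_zero hc
  have hz0 : ∫ s, g s - a * f s - b * f' s ∂P = 0 := by
    have h1 : Integrable (fun s => g s - a * f s) P := hgi.sub (hfi.const_mul a)
    rw [integral_sub h1 (hf'i.const_mul b),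
      integral_sub hgi (hfi.const_mul a), integral_const_mul, integral_const_mul, hg0, hf0, hf'0]
    simp
  have hr0 : ∫ s, f s - c * f' s ∂P = 0 := by
    rw [integral_sub hfi (hf'i.const_mul c), integral_const_mul, hf0, hf'0]
    simp
  have hzi : Integrable (fun s => g s - a * f s - b * f' s) P :=
    (hgi.sub (hfi.const_mul a)).sub (hf'i.const_mul b)
  have hri : Integrable (fun s => f s - c * f' s) P := hfi.sub (hf'i.const_mul c)
  refine ⟨b, c, fun s => g s - a * f s - b * f' s, fun s => f s - c * f' s,
    { measurable_f := hf
      measurable_f' := hf'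
      measurable_z := by fun_prop
      measurable_r := by fun_prop
      eq_g := fun s => by ring
      eq_f := fun s => by ring
      gaussian := hGr
      indep_z := hzind
      indep_r := hrind
      mean_z := hz0
      mean_r := hr0
      mean_f' := hf'0
      condVar_g := ?_
      condVar_f := ?_ }⟩
  · exact meanCondVar_eq_of_indepFun (hf.prodMk hf') (h := fun p => a * p.1 + b * p.2)
      (by fun_prop) (by fun_prop) (fun s => by ring) hzind
      ((hfi.const_mul a).add (hf'i.const_mul b)) hzi hz0
  · exact meanCondVar_eq_of_indepFun hf' (h := fun x => c * x)
      (by fun_prop) (by fun_prop) (fun s => by ring) hrind (hf'i.const_mul c) hri hr0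

end Regression

/-! ### The converse -/

section Block

variable {P : Measure Letter} [IsProbabilityMeasure P] {τ : Type} [MeasurableSpace τ] {n : ℕ}
  {μ : Measure ((Fin n → Letter) × τ)}

theorem map_letter (hμ : μ.map Prod.fst = Measure.pi fun _ => P) (i : Fin n) :
    μ.map (fun p => p.1 i) = P := by
  have h := (measurePreserving_eval (fun _ : Fin n => P) i).map_eq
  rw [← hμ, Measure.map_map (measurable_pi_apply i) measurable_fst] at h
  exact h

theorem measurable_seq {u : Letter → ℝ} (hu : Measurable u) : Measurable (seq (n := n) u) := by
  unfold seq
  fun_prop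

theorem map_seq (hμ : μ.map Prod.fst = Measure.pi fun _ => P) {u : Letter → ℝ}
    (hu : Measurable u) : μ.map (fun p => seq u p.1) = Measure.pi fun _ => P.map u := by
  have := Measure.isProbabilityMeasure_map (μ := P) hu.aemeasurable
  rw [← Measure.pi_map_pi fun _ => hu.aemeasurable, ← hμ,
    Measure.map_map (by fun_prop) measurable_fst]
  rfl

theorem integral_letter (hμ : μ.map Prod.fst = Measure.pi fun _ => P) {u : Letter → ℝ}
    (hu : Measurable u) (i : Fin n) : ∫ p, u (p.1 i) ∂μ = ∫ s, u s ∂P := by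
  conv_rhs => rw [← map_letter hμ i, integral_map (by fun_prop) (by fun_prop)]

theorem memLp_letter (hμ : μ.map Prod.fst = Measure.pi fun _ => P) {u : Letter → ℝ}
    (hu : MemLp u 2 P) (i : Fin n) : MemLp (fun p => u (p.1 i)) 2 μ := by
  rw [← map_letter hμ i] at hu
  exact hu.comp_of_map (by fun_prop)

/-- What the agent with public letters `f'` knows at the end of a block. -/
def view (f' : Letter → ℝ) (p : (Fin n → Letter) × τ) : (Fin n → ℝ) × τ := (seq f' p.1, p.2)

variable {f g f' z r : Letter → ℝ} {a b c : ℝ}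

theorem measurable_view (hf' : Measurable f') : Measurable (view (n := n) (τ := τ) f') :=
  ((measurable_seq hf').comp measurable_fst).prodMk measurable_snd

theorem memLp_two_of_lintegral_sq_ne_top {Ω : Type} [MeasurableSpace Ω] {ν : Measure Ω}
    {e : Ω → ℝ} (he : Measurable e) (h : ∫⁻ ω, ENNReal.ofReal (e ω ^ 2) ∂ν ≠ ∞) :
    MemLp e 2 ν := by
  rw [memLp_two_iff_integrable_sq he.aestronglyMeasurable]
  refine ⟨(he.pow_const 2).aestronglyMeasurable, ?_⟩
  rw [hasFiniteIntegral_iff_ofReal (ae_of_all _ fun _ => sq_nonneg _)]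
  exact h.lt_top

/-- Any estimator G of f from the view becomes the estimator aG + bf' of g, whose error a(f − G) + z
has second moment a²E(f − G)² + E z². The lower bound for mutual information is then applied with a
free parameter d. -/
theorem le_leakage_of_distortion_le [IsProbabilityMeasure μ]
    (hreg : IsRegression P g f f' a b c z r) {s : ℝ≥0}
    (hs : s ≠ 0) (hgs : P.map g = gaussianReal 0 s)
    (hμ : μ.map Prod.fst = Measure.pi fun _ => P)
    (hind : IndepFun (fun p => seq z p.1) (fun p => ((seq f p.1, seq f' p.1), p.2)) μ)
    {G : (Fin n → ℝ) × τ → Fin n → ℝ} (hG : Measurable G) (hn : n ≠ 0) {D : ℝ} (hD0 : 0 ≤ D)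
    (hD : (∑ i, ∫⁻ p, ENNReal.ofReal ((f (p.1 i) - G (view f' p) i) ^ 2) ∂μ) / (n : ℝ≥0∞)
      ≤ ENNReal.ofReal D) {d : ℝ≥0} (hd : d ≠ 0) :
    ENNReal.ofReal (1 / 2 * Real.log (s / d) + 1 / 2 - (a ^ 2 * D + ∫ s, z s ^ 2 ∂P) / (2 * d))
      ≤ mutualInfo μ (fun p => seq g p.1) (view f') / (n : ℝ≥0∞) := by
  have hf := hreg.measurable_f
  have hf' := hreg.measurable_f'
  have hz := hreg.measurable_z
  have hg : Measurable g := by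
    rw [funext hreg.eq_g]
    fun_prop
  have hview : Measurable (view (n := n) (τ := τ) f') := measurable_view hf'
  have hn0 : (n : ℝ≥0∞) ≠ 0 := by simpa using hn
  have hnpos : (0 : ℝ) < n := by positivity
  have hd' : (0 : ℝ) < d := by positivity
  have hG' : ∀ i, Measurable fun p : (Fin n → Letter) × τ => G (view f' p) i := fun i =>
    (measurable_pi_apply i).comp (hG.comp hview)
  have he : ∀ i, Measurable fun p : (Fin n → Letter) × τ => f (p.1 i) - G (view f' p) i :=
    fun i => (by fun_prop : Measurable fun p : (Fin n → Letter) × τ => f (p.1 i)).sub (hG' i)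
  rw [ENNReal.div_le_iff hn0 (ENNReal.natCast_ne_top n), ← ENNReal.ofReal_natCast,
    ← ENNReal.ofReal_mul hD0] at hD
  -- Square integrability of the error is not assumed of the reconstruction; it comes from the
  -- finite distortion.
  have hfin : ∀ i, ∫⁻ p, ENNReal.ofReal ((f (p.1 i) - G (view f' p) i) ^ 2) ∂μ ≠ ∞ := fun i =>
    ((Finset.single_le_sum (f := fun i =>
      ∫⁻ p, ENNReal.ofReal ((f (p.1 i) - G (view f' p) i) ^ 2) ∂μ)
      (fun _ _ => zero_le) (Finset.mem_univ i)).trans_lt (hD.trans_lt ENNReal.ofReal_lt_top)).ne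
  have he2 : ∀ i, MemLp (fun p => f (p.1 i) - G (view f' p) i) 2 μ := fun i =>
    memLp_two_of_lintegral_sq_ne_top (he i) (hfin i)
  have hsum : ∑ i, ∫ p, (f (p.1 i) - G (view f' p) i) ^ 2 ∂μ ≤ D * n := by
    rw [← ENNReal.ofReal_le_ofReal_iff (by positivity),
      ENNReal.ofReal_sum_of_nonneg fun i _ => integral_nonneg fun _ => sq_nonneg _]
    refine le_trans (le_of_eq (Finset.sum_congr rfl fun i _ => ?_)) hD
    exact ofReal_integral_eq_lintegral_ofReal (he2 i).integrable_sq
      (ae_of_all _ fun _ => sq_nonneg _)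
  have hz2 : MemLp z 2 P := hreg.gaussian.fst.memLp_two
  have hzi := fun i => memLp_letter hμ hz2 i
  let h : (Fin n → ℝ) × τ → Fin n → ℝ := fun w i => a * G w i + b * w.1 i
  have hh : Measurable h := measurable_pi_lambda _ fun i =>
    (((measurable_pi_apply i).comp hG).const_mul a).add
      (by fun_prop : Measurable fun w : (Fin n → ℝ) × τ => b * w.1 i)
  have herr : ∀ i p, seq g p.1 i - h (view f' p) i
      = a * (f (p.1 i) - G (view f' p) i) + z (p.1 i) := by
    intro i p
    simp only [h, view, seq, hreg.eq_g]
    ring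
  have hZ : ∀ i, MemLp (fun p => seq g p.1 i - h (view f' p) i) 2 μ := by
    intro i
    simp only [herr]
    exact ((he2 i).const_mul a).add (hzi i)
  -- The reconstruction error is a function of both public sequences and the transcript, hence
  -- independent of the centered residual z.
  have hcross : ∀ i, ∫ p, (f (p.1 i) - G (view f' p) i) * z (p.1 i) ∂μ = 0 := by
    intro i
    have hi : IndepFun (fun p => f (p.1 i) - G (view f' p) i) (fun p => z (p.1 i)) μ := by
      have hφ : Measurable fun q : ((Fin n → ℝ) × (Fin n → ℝ)) × τ =>
          q.1.1 i - G (q.1.2, q.2) i :=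
        (by fun_prop : Measurable fun q : ((Fin n → ℝ) × (Fin n → ℝ)) × τ => q.1.1 i).sub
          ((measurable_pi_apply i).comp (hG.comp
            ((measurable_snd.comp measurable_fst).prodMk measurable_snd)))
      exact hind.symm.comp hφ (measurable_pi_apply i)
    have hz0 : ∫ p, z (p.1 i) ∂μ = 0 := (integral_letter hμ hz i).trans hreg.mean_z
    have := hi.integral_mul_eq_mul_integral (he i).aestronglyMeasurable
      (by fun_prop : Measurable fun p : (Fin n → Letter) × τ => z (p.1 i)).aestronglyMeasurable
    rw [hz0, mul_zero] at this
    exact this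
  have hsq : ∀ i, ∫ p, (seq g p.1 i - h (view f' p) i) ^ 2 ∂μ
      = a ^ 2 * ∫ p, (f (p.1 i) - G (view f' p) i) ^ 2 ∂μ + ∫ s, z s ^ 2 ∂P := by
    intro i
    have h1 := (he2 i).integrable_sq.const_mul (a ^ 2)
    have h2 : Integrable (fun p => 2 * a * ((f (p.1 i) - G (view f' p) i) * z (p.1 i))) μ :=
      ((he2 i).integrable_mul (hzi i)).const_mul (2 * a)
    have h3 := (hzi i).integrable_sq
    have h12 : Integrable (fun p => a ^ 2 * (f (p.1 i) - G (view f' p) i) ^ 2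
        + 2 * a * ((f (p.1 i) - G (view f' p) i) * z (p.1 i))) μ := h1.add h2
    have hexp : ∀ p : (Fin n → Letter) × τ, (seq g p.1 i - h (view f' p) i) ^ 2
        = (a ^ 2 * (f (p.1 i) - G (view f' p) i) ^ 2
          + 2 * a * ((f (p.1 i) - G (view f' p) i) * z (p.1 i))) + z (p.1 i) ^ 2 := fun p => by
      rw [herr]
      ring
    simp only [hexp]
    rw [integral_add h12 h3, integral_add h1 h2, integral_const_mul, integral_const_mul,
      hcross, integral_letter hμ (hz.pow_const 2)]
    ring
  have hmap : μ.map (fun p => seq g p.1) = Measure.pi fun _ => gaussianReal 0 s := by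
    rw [map_seq hμ hg, hgs]
  have hgseq : Measurable fun p : (Fin n → Letter) × τ => seq g p.1 :=
    (measurable_seq hg).comp measurable_fst
  have key := le_mutualInfo hs hd hgseq hview hmap hh hZ
  rw [ENNReal.le_div_iff_mul_le (Or.inl hn0) (Or.inl (ENNReal.natCast_ne_top n)),
    ← ENNReal.ofReal_natCast, ← ENNReal.ofReal_mul' hnpos.le]
  refine le_trans (ENNReal.ofReal_le_ofReal ?_) key
  simp only [hsq, Finset.sum_add_distrib, ← Finset.mul_sum, Finset.sum_const, Finset.card_univ,
    Fintype.card_fin, nsmul_eq_mul]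
  have : (a ^ 2 * ∑ i, ∫ p, (f (p.1 i) - G (view f' p) i) ^ 2 ∂μ + n * ∫ s, z s ^ 2 ∂P) / (2 * d)
      ≤ (a ^ 2 * (D * n) + n * ∫ s, z s ^ 2 ∂P) / (2 * d) := by gcongr
  have e : (a ^ 2 * (D * n) + n * ∫ s, z s ^ 2 ∂P) / (2 * d)
      = n * ((a ^ 2 * D + ∫ s, z s ^ 2 ∂P) / (2 * d)) := by ring
  rw [e] at this
  linarith

end Block

/-- This is the optimisation over the free variance d. Its best value is d = N, and for N = 0 the
bound is unbounded as d tends to 0. -/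
theorem leakageBound_of_forall_le {P : Measure Letter} {g f f' : Letter → ℝ} {a D L : ℝ} {s : ℝ≥0}
    (hs : s ≠ 0) (hvar : variance g P = s) (hN : 0 ≤ errorVar P g f f' a D)
    (h : ∀ d : ℝ≥0, d ≠ 0 →
      1 / 2 * Real.log (s / d) + 1 / 2 - errorVar P g f f' a D / (2 * d) ≤ L) :
    LeakageBound P g f f' a D L := by
  set N := errorVar P g f f' a D
  have hs' : (0 : ℝ) < s := by positivity
  rcases hN.eq_or_lt with h0 | hpos
  · exfalso
    -- With this d, (1/2) log(s/d) = L, and the surviving 1/2 contradicts the upper bound L.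
    let d : ℝ≥0 := s * (Real.exp (-(2 * L))).toNNReal
    have hd : (d : ℝ) = s * Real.exp (-(2 * L)) := by
      simp only [d, NNReal.coe_mul, Real.coe_toNNReal _ (Real.exp_pos _).le]
    have hd0 : d ≠ 0 := by
      rw [← NNReal.coe_ne_zero, hd]
      positivity
    have := h d hd0
    rw [← h0, hd, div_mul_cancel_left₀ hs'.ne', ← Real.exp_neg, Real.log_exp] at this
    simp only [zero_div] at this
    linarith
  · refine ⟨hpos, ?_⟩
    have := h N.toNNReal (Real.toNNReal_pos.2 hpos).ne'
    rw [Real.coe_toNNReal _ hN] at this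
    rw [hvar]
    have e : N / (2 * N) = 1 / 2 := by field_simp
    rw [e] at this
    linarith

theorem le_of_limsup_le {u : ℕ → ℝ≥0∞} {x : ℝ}
    (h : ((limsup u atTop : ℝ≥0∞) : EReal) ≤ (x : EReal)) :
    0 ≤ x ∧ ∀ ε > 0, ∀ᶠ n in atTop, u n ≤ ENNReal.ofReal (x + ε) := by
  have h0 : 0 ≤ x := by
    have : ((0 : ℝ) : EReal) ≤ (x : EReal) := (EReal.coe_ennreal_nonneg _).trans h
    exact_mod_cast this
  refine ⟨h0, fun ε hε => ?_⟩
  have h1 : limsup u atTop ≤ ENNReal.ofReal x := by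
    rw [← EReal.coe_ennreal_le_coe_ennreal_iff, EReal.coe_ennreal_ofReal, max_eq_left h0]
    exact h
  have h2 : limsup u atTop < ENNReal.ofReal (x + ε) :=
    h1.trans_lt ((ENNReal.ofReal_lt_ofReal_iff (by linarith)).2 (by linarith))
  exact (eventually_lt_of_limsup_lt h2).mono fun n hn => hn.le

/-! ### Laws of interactive mechanisms -/

section Mechanism

variable {𝒰 : ℕ → Type} [∀ k, MeasurableSpace (𝒰 k)] {n K : ℕ} {P : Measure Letter}
  [IsProbabilityMeasure P]

theorem measurable_X₁ : Measurable X₁ := by unfold X₁; fun_prop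
theorem measurable_Y₁ : Measurable Y₁ := by unfold Y₁; fun_prop
theorem measurable_X₂ : Measurable X₂ := by unfold X₂; fun_prop
theorem measurable_Y₂ : Measurable Y₂ := by unfold Y₂; fun_prop

instance isProbabilityMeasure_law (M : Mechanism 𝒰 n K) : IsProbabilityMeasure (M.law P) := by
  unfold Mechanism.law
  infer_instance

theorem map_fst_law (M : Mechanism 𝒰 n K) :
    (M.law P).map Prod.fst = Measure.pi fun _ => P := by
  have := Measure.fst_compProd (Measure.pi fun _ : Fin n => P)
    ((M.transcriptKernel K).comap (fun s => (seq X₁ s, seq X₂ s))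
      (by unfold seq X₁ X₂; fun_prop))
  exact this

/-- The order of speaking and the number of rounds disappear here: all messages together are one
kernel applied to the pair of public sequences. -/
theorem indepFun_seq_law (M : Mechanism 𝒰 n K) {z : Letter → ℝ} (hz : Measurable z)
    (h : IndepFun z (fun s => (X₁ s, X₂ s)) P) :
    IndepFun (fun p => seq z p.1) (fun p => ((seq X₁ p.1, seq X₂ p.1), p.2)) (M.law P) := by
  have hπ : Measurable fun s : Fin n → Letter => (seq X₁ s, seq X₂ s) := by
    unfold seq X₁ X₂
    fun_prop
  have h1 := indepFun_pi hz (measurable_X₁.prodMk measurable_X₂) h n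
  have h2 : IndepFun (seq z) (fun s : Fin n → Letter => (seq X₁ s, seq X₂ s))
      (Measure.pi fun _ => P) :=
    h1.comp (φ := id) (ψ := fun v : Fin n → ℝ × ℝ => (fun i => (v i).1, fun i => (v i).2))
      measurable_id (by fun_prop)
  exact indepFun_compProd_comap hπ (M.transcriptKernel K) (measurable_seq hz) h2

end Mechanism

/-- The converse for one of the two agents. -/
theorem leakageBound_of_limsup_le {P : Measure Letter} [IsProbabilityMeasure P]
    {f g f' z r : Letter → ℝ} {a b c : ℝ} (hreg : IsRegression P g f f' a b c z r)
    (hG : HasGaussianLaw g P) (hg0 : ∫ s, g s ∂P = 0) (hvar : 0 < variance g P)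
    {τ : ℕ → Type} [∀ n, MeasurableSpace (τ n)] {μ : ∀ n, Measure ((Fin n → Letter) × τ n)}
    [∀ n, IsProbabilityMeasure (μ n)] (hμ : ∀ n, (μ n).map Prod.fst = Measure.pi fun _ => P)
    (hind : ∀ n, IndepFun (fun p => seq z p.1) (fun p => ((seq f p.1, seq f' p.1), p.2)) (μ n))
    {G : ∀ n, (Fin n → ℝ) × τ n → Fin n → ℝ} (hGm : ∀ n, Measurable (G n)) {D L : ℝ}
    (hD : ((limsup (fun n => (∑ i, ∫⁻ p, ENNReal.ofReal ((f (p.1 i) - G n (view f' p) i) ^ 2)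
      ∂(μ n)) / (n : ℝ≥0∞)) atTop : ℝ≥0∞) : EReal) ≤ (D : EReal))
    (hL : ((limsup (fun n => mutualInfo (μ n) (fun p => seq g p.1) (view f') / (n : ℝ≥0∞)) atTop
      : ℝ≥0∞) : EReal) ≤ (L : EReal)) :
    0 ≤ D ∧ LeakageBound P g f f' a D L := by
  obtain ⟨hD0, hDε⟩ := le_of_limsup_le hD
  obtain ⟨hL0, hLε⟩ := le_of_limsup_le hL
  refine ⟨hD0, ?_⟩
  have hr := hreg.measurable_r
  have hr2 : MemLp r 2 P := hreg.gaussian.snd.fst.memLp_two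
  have hrnn : 0 ≤ ∫ s, r s ^ 2 ∂P := integral_nonneg fun _ => sq_nonneg _
  have hznn : 0 ≤ ∫ s, z s ^ 2 ∂P := integral_nonneg fun _ => sq_nonneg _
  have hs : (variance g P).toNNReal ≠ 0 := by
    rw [← pos_iff_ne_zero]
    exact Real.toNNReal_pos.2 hvar
  have hsc : ((variance g P).toNNReal : ℝ) = variance g P := Real.coe_toNNReal _ hvar.le
  have hgs : P.map g = gaussianReal 0 (variance g P).toNNReal := by
    rw [hG.map_eq_gaussianReal, hg0]
  have herr : errorVar P g f f' a D
      = a ^ 2 * min D (∫ s, r s ^ 2 ∂P) + ∫ s, z s ^ 2 ∂P := by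
    rw [errorVar, hreg.condVar_f, hreg.condVar_g]
  refine leakageBound_of_forall_le hs hsc.symm ?_ fun d hd => ?_
  · rw [herr]
    have : 0 ≤ min D (∫ s, r s ^ 2 ∂P) := le_min hD0 hrnn
    positivity
  have hd' : (0 : ℝ) < d := by positivity
  -- The slack ε in the distortion and in the leakage is removed by letting ε decrease to 0. Length
  -- n = 0 is excluded because of the division by n.
  have step : ∀ E : ℝ, 0 ≤ E → (∀ ε > 0, ∀ᶠ n in atTop, n ≠ 0 →
      ENNReal.ofReal (1 / 2 * Real.log ((variance g P).toNNReal / d) + 1 / 2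
          - (a ^ 2 * (E + ε) + ∫ s, z s ^ 2 ∂P) / (2 * d))
        ≤ mutualInfo (μ n) (fun p => seq g p.1) (view f') / (n : ℝ≥0∞)) →
      1 / 2 * Real.log ((variance g P).toNNReal / d) + 1 / 2
        - (a ^ 2 * E + ∫ s, z s ^ 2 ∂P) / (2 * d) ≤ L := by
    intro E hE hev
    have hε : ∀ ε > 0, 1 / 2 * Real.log ((variance g P).toNNReal / d) + 1 / 2
        - (a ^ 2 * (E + ε) + ∫ s, z s ^ 2 ∂P) / (2 * d) ≤ L + ε := by
      intro ε hε
      obtain ⟨n, h1, h2, h3⟩ := ((hev ε hε).and ((hLε ε hε).and (eventually_ne_atTop 0))).exists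
      exact (ENNReal.ofReal_le_ofReal_iff (by linarith)).1 ((h1 h3).trans h2)
    have hcont : Tendsto (fun ε : ℝ => (1 / 2 * Real.log ((variance g P).toNNReal / d) + 1 / 2
        - (a ^ 2 * (E + ε) + ∫ s, z s ^ 2 ∂P) / (2 * d)) - ε) (nhdsWithin 0 (Set.Ioi 0))
        (nhds ((1 / 2 * Real.log ((variance g P).toNNReal / d) + 1 / 2
        - (a ^ 2 * (E + 0) + ∫ s, z s ^ 2 ∂P) / (2 * d)) - 0)) := by
      refine tendsto_nhdsWithin_of_tendsto_nhds (Continuous.tendsto ?_ 0)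
      fun_prop
    have := le_of_tendsto hcont (b := L) (by
      filter_upwards [self_mem_nhdsWithin] with ε hε'
      have := hε ε hε'
      linarith)
    simpa using this
  have hbound1 := step D hD0 fun ε hε => by
    filter_upwards [hDε ε hε] with n hn hn0
    exact le_leakage_of_distortion_le hreg hs hgs (hμ n) (hind n) (hGm n) hn0
      (by linarith) hn hd
  -- The same leakage is bounded a second time with the linear regression c·f' as the estimator of
  -- f. It ignores the transcript and has error variance E r², which produces the second term of the
  -- minimum.
  have hbound2 := step (∫ s, r s ^ 2 ∂P) hrnn fun ε hε => by
    filter_upwards with n hn0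
    refine le_leakage_of_distortion_le hreg hs hgs (hμ n) (hind n) (G := fun w i => c * w.1 i)
      (by fun_prop) hn0 (by linarith) ?_ hd
    have hi : ∀ i, ∫⁻ p, ENNReal.ofReal ((f (p.1 i) - c * (view f' p).1 i) ^ 2) ∂(μ n)
        = ENNReal.ofReal (∫ s, r s ^ 2 ∂P) := by
      intro i
      rw [← integral_letter (hμ n) (hr.pow_const 2) i, ofReal_integral_eq_lintegral_ofReal
        (memLp_letter (hμ n) hr2 i).integrable_sq (ae_of_all _ fun _ => sq_nonneg _)]
      refine lintegral_congr fun p => ?_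
      simp only [view, seq, hreg.eq_f (p.1 i)]
      congr 1
      ring
    simp only [hi, Finset.sum_const, Finset.card_univ, Fintype.card_fin, nsmul_eq_mul]
    rw [mul_comm, ENNReal.mul_div_cancel_right (by simpa using hn0) (ENNReal.natCast_ne_top n)]
    exact ENNReal.ofReal_le_ofReal (by linarith)
  rw [herr]
  rcases min_cases D (∫ s, r s ^ 2 ∂P) with h | h
  · rw [h.1]
    exact hbound1
  · rw [h.1]
    exact hbound2

/-! ### One letter sent through Gaussian channels -/

/-- A letter `π` of the source `P` together with independent Gaussian noise variables `v`, `v'`, where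
`v` has variance `q`. -/
structure IsNoisyLetter {Λ : Type} [MeasurableSpace Λ] (ρ : Measure Λ) (P : Measure Letter)
    (π : Λ → Letter) (v v' : Λ → ℝ) (q : ℝ≥0) : Prop where
  measurable_π : Measurable π
  measurable_v : Measurable v
  measurable_v' : Measurable v'
  map_π : ρ.map π = P
  map_v : ρ.map v = gaussianReal 0 q
  gaussian : HasGaussianLaw (fun ω => (v ω, v' ω)) ρ
  indep_noise : IndepFun v v' ρ
  indep_letter : IndepFun π (fun ω => (v ω, v' ω)) ρ

section Letter

variable {Λ : Type} [MeasurableSpace Λ] {ρ : Measure Λ} {P : Measure Letter} {π : Λ → Letter} {v v' : Λ → ℝ} {q : ℝ≥0}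
  {g f f' z r : Letter → ℝ} {a b c e γ : ℝ}

/-- The error of the linear estimator of `g` from `f'` and the channel output `e f + v`. -/
def estimationError (a e γ : ℝ) (z r : Letter → ℝ) (π : Λ → Letter) (v : Λ → ℝ) (ω : Λ) : ℝ :=
  a * ((1 - γ * e) * r (π ω) - γ * v ω) + z (π ω)

theorem IsRegression.covariances (hreg : IsRegression P g f f' a b c z r) :
    cov[z, r; P] = 0 ∧ cov[z, f'; P] = 0 ∧ cov[r, f'; P] = 0 ∧
      Var[r; P] = ∫ s, r s ^ 2 ∂P ∧ Var[z; P] = ∫ s, z s ^ 2 ∂P := by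
  have hz := hreg.gaussian.fst.memLp_two
  have hr := hreg.gaussian.snd.fst.memLp_two
  have hf' := hreg.gaussian.snd.snd.memLp_two
  have hzr : IndepFun z r P := by
    have hr' : r = (fun p : ℝ × ℝ => p.1 - c * p.2) ∘ fun s => (f s, f' s) := by
      funext s
      simp only [Function.comp_apply, hreg.eq_f s]
      ring
    rw [hr']
    exact hreg.indep_z.comp measurable_id (by fun_prop)
  have hzf' : IndepFun z f' P := hreg.indep_z.comp measurable_id measurable_snd
  refine ⟨hzr.covariance_eq_zero hz hr, hzf'.covariance_eq_zero hz hf',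
    hreg.indep_r.covariance_eq_zero hr hf', ?_, ?_⟩
  · exact variance_of_integral_eq_zero hreg.measurable_r.aemeasurable hreg.mean_r
  · exact variance_of_integral_eq_zero hreg.measurable_z.aemeasurable hreg.mean_z

/-- In g = a r + (ac + b) f' + z the three terms are uncorrelated, so their variances add. This
makes the logarithm in the leakage bound nonnegative. -/
theorem IsRegression.errorVar_le_variance [IsProbabilityMeasure P]
    (hreg : IsRegression P g f f' a b c z r) (D : ℝ) :
    errorVar P g f f' a D ≤ variance g P := by
  obtain ⟨hzr, hzf', hrf', hvr, hvz⟩ := hreg.covariances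
  have hz := hreg.gaussian.fst.memLp_two
  have hr := hreg.gaussian.snd.fst.memLp_two
  have hf' := hreg.gaussian.snd.snd.memLp_two
  have hg : g = (fun s => a * r s) + ((fun s => (a * c + b) * f' s) + z) := by
    funext s
    simp only [Pi.add_apply, hreg.eq_g s, hreg.eq_f s]
    ring
  have h1 : MemLp (fun s => a * r s) 2 P := hr.const_mul a
  have h2 : MemLp (fun s => (a * c + b) * f' s) 2 P := hf'.const_mul _
  rw [errorVar, hreg.condVar_f, hreg.condVar_g, hg, variance_add h1 (h2.add hz),
    covariance_add_right h1 h2 hz, variance_add h2 hz]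
  simp only [covariance_const_mul_left, covariance_const_mul_right, variance_const_mul, hrf',
    covariance_comm r z, covariance_comm f' z, hzr, hzf', hvr, hvz]
  have h3 := mul_le_mul_of_nonneg_left (min_le_right D (∫ s, r s ^ 2 ∂P)) (sq_nonneg a)
  have h4 := mul_nonneg (sq_nonneg (a * c + b)) (variance_nonneg f' P)
  linarith

theorem IsNoisyLetter.hasGaussianLaw (hN : IsNoisyLetter ρ P π v v' q)
    (hreg : IsRegression P g f f' a b c z r) :
    HasGaussianLaw (fun ω => ((z (π ω), r (π ω), f' (π ω)), (v ω, v' ω))) ρ := by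
  have hm : Measurable fun s => (z s, r s, f' s) :=
    hreg.measurable_z.prodMk (hreg.measurable_r.prodMk hreg.measurable_f')
  refine IndepFun.hasGaussianLaw ⟨?_⟩ hN.gaussian (hN.indep_letter.comp hm measurable_id)
  have := hreg.gaussian.isGaussian_map
  rw [← hN.map_π, Measure.map_map hm hN.measurable_π] at this
  exact this

theorem IsNoisyLetter.covariance_comp (hN : IsNoisyLetter ρ P π v v' q) {x y : Letter → ℝ}
    (hx : Measurable x) (hy : Measurable y) :
    cov[fun ω => x (π ω), fun ω => y (π ω); ρ] = cov[x, y; P] := by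
  have hπ := hN.measurable_π
  rw [← hN.map_π, covariance_map_fun hx.aestronglyMeasurable hy.aestronglyMeasurable
    hπ.aemeasurable]

theorem IsNoisyLetter.covariance_estimationError [IsProbabilityMeasure ρ]
    (hN : IsNoisyLetter ρ P π v v' q)
    (hreg : IsRegression P g f f' a b c z r) {X : Λ → ℝ} (hX : MemLp X 2 ρ) :
    cov[estimationError a e γ z r π v, X; ρ]
      = a * (1 - γ * e) * cov[fun ω => r (π ω), X; ρ] - a * γ * cov[v, X; ρ]
        + cov[fun ω => z (π ω), X; ρ] := by
  have hG := hN.hasGaussianLaw hreg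
  have hz := hG.fst.fst.memLp_two
  have hr := hG.fst.snd.fst.memLp_two
  have hv := hG.snd.fst.memLp_two
  have : estimationError a e γ z r π v
      = (fun ω => a * (1 - γ * e) * r (π ω)) + ((fun ω => -(a * γ) * v ω) + fun ω => z (π ω)) := by
    funext ω
    simp only [estimationError, Pi.add_apply]
    ring
  rw [this, covariance_add_left (hr.const_mul _) ((hv.const_mul _).add hz) hX,
    covariance_add_left (hv.const_mul _) hz hX, covariance_const_mul_left,
    covariance_const_mul_left]
  ring

theorem IsNoisyLetter.noise_covariances [IsProbabilityMeasure ρ]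
    (hN : IsNoisyLetter ρ P π v v' q)
    (hreg : IsRegression P g f f' a b c z r) {x : Letter → ℝ} (hx : Measurable x)
    (hx2 : MemLp (fun ω => x (π ω)) 2 ρ) :
    cov[fun ω => x (π ω), v; ρ] = 0 ∧ cov[fun ω => x (π ω), v'; ρ] = 0 := by
  have hG := hN.hasGaussianLaw hreg
  exact ⟨(hN.indep_letter.comp hx measurable_fst).covariance_eq_zero hx2 hG.snd.fst.memLp_two,
    (hN.indep_letter.comp hx measurable_snd).covariance_eq_zero hx2 hG.snd.snd.memLp_two⟩

theorem IsNoisyLetter.variance_noise (hN : IsNoisyLetter ρ P π v v' q) : Var[v; ρ] = q := by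
  have h := variance_id_gaussianReal (μ := 0) (v := q)
  rw [← hN.map_v, variance_map aemeasurable_id hN.measurable_v.aemeasurable] at h
  exact h

/-- This is the orthogonality principle. `hγ` says that the estimator's error (1 − γe)r − γv is
uncorrelated with the innovation er + v of the channel output. The other noise v' is included among
the observations because the view also contains the agent's own message, which is built from f' and
v'. -/
theorem IsNoisyLetter.indepFun_estimationError [IsProbabilityMeasure ρ]
    (hN : IsNoisyLetter ρ P π v v' q)
    (hreg : IsRegression P g f f' a b c z r)
    (hγ : e * (1 - γ * e) * ∫ s, r s ^ 2 ∂P = γ * q) :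
    IndepFun (estimationError a e γ z r π v)
      (fun ω => (f' (π ω), e * f (π ω) + v ω, v' ω)) ρ := by
  have hG := hN.hasGaussianLaw hreg
  obtain ⟨hzr, hzf', hrf', hvr, hvz⟩ := hreg.covariances
  have hz := hG.fst.fst.memLp_two
  have hr := hG.fst.snd.fst.memLp_two
  have hf' := hG.fst.snd.snd.memLp_two
  have hv := hG.snd.fst.memLp_two
  have hv' := hG.snd.snd.memLp_two
  obtain ⟨hzv, hzv'⟩ := hN.noise_covariances hreg hreg.measurable_z hz
  obtain ⟨hrv, hrv'⟩ := hN.noise_covariances hreg hreg.measurable_r hr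
  obtain ⟨hf'v, hf'v'⟩ := hN.noise_covariances hreg hreg.measurable_f' hf'
  have hvv' : cov[v, v'; ρ] = 0 := hN.indep_noise.covariance_eq_zero hv hv'
  have hvv : cov[v, v; ρ] = q := by
    rw [covariance_self hN.measurable_v.aemeasurable, hN.variance_noise]
  have hrr : cov[fun ω => r (π ω), fun ω => r (π ω); ρ] = ∫ s, r s ^ 2 ∂P := by
    rw [hN.covariance_comp hreg.measurable_r hreg.measurable_r,
      covariance_self hreg.measurable_r.aemeasurable, hvr]
  have hU : (fun ω => e * f (π ω) + v ω)
      = (fun ω => e * c * f' (π ω)) + ((fun ω => e * r (π ω)) + v) := by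
    funext ω
    simp only [Pi.add_apply, hreg.eq_f]
    ring
  have hU2 : MemLp (fun ω => e * f (π ω) + v ω) 2 ρ := by
    rw [hU]
    exact (hf'.const_mul _).add ((hr.const_mul _).add hv)
  have hcovU : ∀ {x : Λ → ℝ}, MemLp x 2 ρ → cov[x, fun ω => e * f (π ω) + v ω; ρ]
      = e * c * cov[x, fun ω => f' (π ω); ρ] + e * cov[x, fun ω => r (π ω); ρ] + cov[x, v; ρ] := by
    intro x hx
    rw [hU, covariance_add_right hx (hf'.const_mul _) ((hr.const_mul _).add hv),
      covariance_add_right hx (hr.const_mul _) hv, covariance_const_mul_right,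
      covariance_const_mul_right]
    ring
  let A : (ℝ × ℝ × ℝ) × ℝ × ℝ →L[ℝ] ℝ × ℝ × ℝ × ℝ := LinearMap.toContinuousLinearMap
    { toFun := fun p => (a * ((1 - γ * e) * p.1.2.1 - γ * p.2.1) + p.1.1, p.1.2.2,
        e * (c * p.1.2.2 + p.1.2.1) + p.2.1, p.2.2)
      map_add' := fun p q => by ext <;> simp <;> ring
      map_smul' := fun t p => by ext <;> simp <;> ring }
  have hA : HasGaussianLaw (fun ω => (estimationError a e γ z r π v ω, f' (π ω),
      e * f (π ω) + v ω, v' ω)) ρ := by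
    have := hG.map_fun A
    simp only [hreg.eq_f]
    exact this
  refine indepFun_prodMk_prodMk_of_covariance_eq_zero hA ?_ ?_ ?_
  · rw [hN.covariance_estimationError hreg hf',
      hN.covariance_comp hreg.measurable_r hreg.measurable_f',
      hN.covariance_comp hreg.measurable_z hreg.measurable_f', covariance_comm v, hf'v, hrf', hzf']
    simp
  · rw [hN.covariance_estimationError hreg hU2, hcovU hr, hcovU hv, hcovU hz, hrr,
      hN.covariance_comp hreg.measurable_r hreg.measurable_f',
      hN.covariance_comp hreg.measurable_z hreg.measurable_f',
      hN.covariance_comp hreg.measurable_z hreg.measurable_r, covariance_comm v, hf'v, hrf', hzf',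
      hzr, covariance_comm v, hrv, hzv, hvv]
    -- What is left of the covariance is a(e(1 − γe)E r² − γq).
    linear_combination a * hγ
  · rw [hN.covariance_estimationError hreg hv', hrv', hzv', hvv']
    simp

theorem IsNoisyLetter.variance_estimationError [IsProbabilityMeasure ρ]
    (hN : IsNoisyLetter ρ P π v v' q)
    (hreg : IsRegression P g f f' a b c z r) :
    Var[estimationError a e γ z r π v; ρ]
      = a ^ 2 * ((1 - γ * e) ^ 2 * ∫ s, r s ^ 2 ∂P + γ ^ 2 * q) + ∫ s, z s ^ 2 ∂P := by
  have hG := hN.hasGaussianLaw hreg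
  obtain ⟨hzr, hzf', hrf', hvr, hvz⟩ := hreg.covariances
  have hz := hG.fst.fst.memLp_two
  have hr := hG.fst.snd.fst.memLp_two
  have hv := hG.snd.fst.memLp_two
  obtain ⟨hzv, -⟩ := hN.noise_covariances hreg hreg.measurable_z hz
  obtain ⟨hrv, -⟩ := hN.noise_covariances hreg hreg.measurable_r hr
  have hvv : cov[v, v; ρ] = q := by
    rw [covariance_self hN.measurable_v.aemeasurable, hN.variance_noise]
  have hrr : cov[fun ω => r (π ω), fun ω => r (π ω); ρ] = ∫ s, r s ^ 2 ∂P := by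
    rw [hN.covariance_comp hreg.measurable_r hreg.measurable_r,
      covariance_self hreg.measurable_r.aemeasurable, hvr]
  have hzz : cov[fun ω => z (π ω), fun ω => z (π ω); ρ] = ∫ s, z s ^ 2 ∂P := by
    rw [hN.covariance_comp hreg.measurable_z hreg.measurable_z,
      covariance_self hreg.measurable_z.aemeasurable, hvz]
  have hrz : cov[fun ω => r (π ω), fun ω => z (π ω); ρ] = 0 := by
    rw [hN.covariance_comp hreg.measurable_r hreg.measurable_z, covariance_comm, hzr]
  have hE2 : MemLp (estimationError a e γ z r π v) 2 ρ :=
    (((hr.const_mul (1 - γ * e)).sub (hv.const_mul γ)).const_mul a).add hz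
  rw [← covariance_self hE2.aemeasurable, hN.covariance_estimationError hreg hE2,
    covariance_comm _ (estimationError a e γ z r π v),
    covariance_comm _ (estimationError a e γ z r π v),
    covariance_comm _ (estimationError a e γ z r π v),
    hN.covariance_estimationError hreg hr, hN.covariance_estimationError hreg hv,
    hN.covariance_estimationError hreg hz, covariance_comm v, covariance_comm v fun ω => z (π ω),
    hrv, hzv, hrr, hvv, hzz, hrz, covariance_comm (fun ω => z (π ω)), hrz]
  ring

theorem IsNoisyLetter.map_estimationError [IsProbabilityMeasure ρ]
    (hN : IsNoisyLetter ρ P π v v' q)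
    (hreg : IsRegression P g f f' a b c z r) :
    ρ.map (estimationError a e γ z r π v) = gaussianReal 0
      (a ^ 2 * ((1 - γ * e) ^ 2 * ∫ s, r s ^ 2 ∂P + γ ^ 2 * q) + ∫ s, z s ^ 2 ∂P).toNNReal := by
  have hG := hN.hasGaussianLaw hreg
  have hz := hG.fst.fst.integrable
  have hr := hG.fst.snd.fst.integrable
  have hv := hG.snd.fst.integrable
  let A : (ℝ × ℝ × ℝ) × ℝ × ℝ →L[ℝ] ℝ := LinearMap.toContinuousLinearMap
    { toFun := fun p => a * ((1 - γ * e) * p.1.2.1 - γ * p.2.1) + p.1.1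
      map_add' := fun p q => by simp; ring
      map_smul' := fun t p => by simp; ring }
  have hA : HasGaussianLaw (estimationError a e γ z r π v) ρ := hG.map_fun A
  have hr0 : ∫ ω, r (π ω) ∂ρ = 0 := by
    rw [← hreg.mean_r, ← hN.map_π, integral_map hN.measurable_π.aemeasurable
      hreg.measurable_r.aestronglyMeasurable]
  have hz0 : ∫ ω, z (π ω) ∂ρ = 0 := by
    rw [← hreg.mean_z, ← hN.map_π, integral_map hN.measurable_π.aemeasurable
      hreg.measurable_z.aestronglyMeasurable]
  have hv0 : ∫ ω, v ω ∂ρ = 0 := by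
    have := integral_id_gaussianReal (μ := 0) (v := q)
    rw [← hN.map_v, integral_map hN.measurable_v.aemeasurable (by fun_prop)] at this
    exact this
  have h0 : ∫ ω, estimationError a e γ z r π v ω ∂ρ = 0 := by
    have h1 : Integrable (fun ω => (1 - γ * e) * r (π ω) - γ * v ω) ρ :=
      (hr.const_mul _).sub (hv.const_mul _)
    simp only [estimationError]
    rw [integral_add (h1.const_mul a) hz, integral_const_mul, integral_sub (hr.const_mul _)
      (hv.const_mul _), integral_const_mul, integral_const_mul, hr0, hz0, hv0]
    simp
  rw [hA.map_eq_gaussianReal, h0, hN.variance_estimationError hreg]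

end Letter

/-! ### A block sent through Gaussian channels -/

theorem mutualInfo_map {Ω Ω' α β : Type} [MeasurableSpace Ω] [MeasurableSpace Ω']
    [MeasurableSpace α] [MeasurableSpace β] {μ : Measure Ω} {Ψ : Ω → Ω'} (hΨ : Measurable Ψ)
    {A : Ω' → α} {B : Ω' → β} (hA : Measurable A) (hB : Measurable B) :
    mutualInfo (μ.map Ψ) A B = mutualInfo μ (fun ω => A (Ψ ω)) (fun ω => B (Ψ ω)) := by
  unfold mutualInfo
  rw [Measure.map_map (hA.prodMk hB) hΨ, Measure.map_map hA hΨ, Measure.map_map hB hΨ]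
  rfl

/-- The linear estimator of `f` from `f'` and from the channel outputs `C w.2`. -/
def linearEstimator {n : ℕ} {τ : Type} (c e γ : ℝ) (C : τ → Fin n → ℝ) (w : (Fin n → ℝ) × τ) :
    Fin n → ℝ :=
  fun i => c * w.1 i + γ * (C w.2 i - e * (c * w.1 i))

theorem measurable_linearEstimator {n : ℕ} {τ : Type} [MeasurableSpace τ] (c e γ : ℝ)
    {C : τ → Fin n → ℝ} (hC : Measurable C) : Measurable (linearEstimator c e γ C) := by
  have h1 : ∀ i, Measurable fun w : (Fin n → ℝ) × τ => C w.2 i := fun i =>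
    (measurable_pi_apply i).comp (hC.comp measurable_snd)
  refine measurable_pi_lambda _ fun i => ?_
  have := h1 i
  unfold linearEstimator
  fun_prop

theorem sub_linearEstimator_eq {Λ τ : Type} {P : Measure Letter} {π : Λ → Letter} {v : Λ → ℝ}
    {g f f' z r : Letter → ℝ} {a b c e γ : ℝ} {n : ℕ} {T : (Fin n → Λ) → τ} {C : τ → Fin n → ℝ}
    (hreg : IsRegression P g f f' a b c z r)
    (hCT : ∀ ω i, C (T ω) i = e * f (π (ω i)) + v (ω i)) (ω : Fin n → Λ) (i : Fin n) :
    f (π (ω i)) - linearEstimator c e γ C (fun i => f' (π (ω i)), T ω) i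
      = (1 - γ * e) * r (π (ω i)) - γ * v (ω i) := by
  simp only [linearEstimator, hCT, hreg.eq_f]
  ring

section Block

variable {Λ : Type} [MeasurableSpace Λ] {ρ : Measure Λ} [IsProbabilityMeasure ρ]
  {P : Measure Letter} {π : Λ → Letter} {v v' : Λ → ℝ} {q : ℝ≥0}
  {g f f' z r : Letter → ℝ} {a b c e e' γ : ℝ} {n : ℕ} {τ : Type} {T : (Fin n → Λ) → τ}
  {C : τ → Fin n → ℝ}

/-- The single-letter error is independent of everything the receiver sees in that letter, and this
passes to i.i.d. blocks. So the view acts on g as a Gaussian channel with noise variance d. The map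
Θ assembles the transcript from the two message sequences, with that of the other agent first. -/
theorem IsNoisyLetter.mutualInfo_block [MeasurableSpace τ]
    (hN : IsNoisyLetter ρ P π v v' q)
    (hreg : IsRegression P g f f' a b c z r)
    (hγ : e * (1 - γ * e) * ∫ s, r s ^ 2 ∂P = γ * q) {Θ : (Fin n → ℝ) → (Fin n → ℝ) → τ}
    (hΘ : Measurable fun p : (Fin n → ℝ) × (Fin n → ℝ) => Θ p.1 p.2)
    (hT : ∀ ω, T ω = Θ (fun i => e * f (π (ω i)) + v (ω i)) (fun i => e' * f' (π (ω i)) + v' (ω i)))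
    (hC : Measurable C) (hCT : ∀ ω i, C (T ω) i = e * f (π (ω i)) + v (ω i)) {s : ℝ≥0} (hs : s ≠ 0)
    (hgs : P.map g = gaussianReal 0 s) {d : ℝ≥0} (hd : d ≠ 0)
    (hdeq : (d : ℝ) = a ^ 2 * ((1 - γ * e) ^ 2 * ∫ s, r s ^ 2 ∂P + γ ^ 2 * q)
      + ∫ s, z s ^ 2 ∂P) :
    mutualInfo (Measure.pi fun _ : Fin n => ρ) (fun ω i => g (π (ω i)))
      (fun ω => ((fun i => f' (π (ω i))), T ω)) = ENNReal.ofReal (n * (1 / 2 * Real.log (s / d))) := by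
  have hf := hreg.measurable_f
  have hf' := hreg.measurable_f'
  have hz := hreg.measurable_z
  have hr := hreg.measurable_r
  have hπ := hN.measurable_π
  have hv := hN.measurable_v
  have hv' := hN.measurable_v'
  have hg : Measurable g := by
    rw [funext hreg.eq_g]
    fun_prop
  have hTm : Measurable T := by
    rw [funext hT]
    exact Measurable.comp (g := fun p : (Fin n → ℝ) × (Fin n → ℝ) => Θ p.1 p.2)
      (f := fun ω : Fin n → Λ => (fun i => e * f (π (ω i)) + v (ω i),
        fun i => e' * f' (π (ω i)) + v' (ω i))) hΘ (by fun_prop)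
  have hEm : Measurable (estimationError a e γ z r π v) := by
    unfold estimationError
    fun_prop
  let h : (Fin n → ℝ) × τ → Fin n → ℝ := fun w i => a * linearEstimator c e γ C w i + b * w.1 i
  have hh : Measurable h := by
    refine measurable_pi_lambda _ fun i => Measurable.add ?_ (by fun_prop)
    exact ((measurable_pi_apply i).comp (measurable_linearEstimator c e γ hC)).const_mul a
  have herr : (fun ω => (fun i => g (π (ω i))) - h ((fun i => f' (π (ω i))), T ω))
      = fun ω i => estimationError a e γ z r π v (ω i) := by
    funext ω i
    have := sub_linearEstimator_eq (γ := γ) hreg hCT ω i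
    simp only [Pi.sub_apply, estimationError, h, hreg.eq_g (π (ω i))]
    linear_combination a * this
  have hW : Measurable fun ω : Fin n → Λ => ((fun i => f' (π (ω i))), T ω) :=
    (by fun_prop : Measurable fun (ω : Fin n → Λ) i => f' (π (ω i))).prodMk hTm
  have hgπ : ρ.map (fun ω => g (π ω)) = gaussianReal 0 s := by
    rw [← hgs, ← hN.map_π, Measure.map_map hg hπ]
    rfl
  refine mutualInfo_eq_of_indepFun hs hd (by fun_prop) hW ?_ hh ?_ ?_
  · have := Measure.isProbabilityMeasure_map (μ := ρ) (hg.comp hπ).aemeasurable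
    have h1 := Measure.pi_map_pi (ι := Fin n) (μ := fun _ => ρ) (f := fun _ ω => g (π ω))
      fun _ => (hg.comp hπ).aemeasurable
    rw [h1, hgπ]
  · rw [herr]
    have := Measure.isProbabilityMeasure_map (μ := ρ) hEm.aemeasurable
    rw [Measure.pi_map_pi (ι := Fin n) (μ := fun _ => ρ) fun _ => hEm.aemeasurable,
      hN.map_estimationError hreg, ← hdeq, Real.toNNReal_coe]
  · rw [herr]
    have h1 := indepFun_pi hEm (v := fun ω => (f' (π ω), e * f (π ω) + v ω, v' ω))
      (by fun_prop) (hN.indepFun_estimationError hreg hγ) n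
    -- The view is a function of f', the received message and v' alone, so independence carries over
    -- to it.
    have h2 : (fun ω : Fin n → Λ => ((fun i => f' (π (ω i))), T ω))
        = (fun w : Fin n → ℝ × ℝ × ℝ => ((fun i => (w i).1),
          Θ (fun i => (w i).2.1) fun i => e' * (w i).1 + (w i).2.2))
          ∘ fun ω i => (f' (π (ω i)), e * f (π (ω i)) + v (ω i), v' (ω i)) := by
      funext ω
      simp only [hT, Function.comp_apply]
    rw [h2]
    refine h1.comp measurable_id (Measurable.prodMk (by fun_prop) ?_)
    exact Measurable.comp (g := fun p : (Fin n → ℝ) × (Fin n → ℝ) => Θ p.1 p.2)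
      (f := fun w : Fin n → ℝ × ℝ × ℝ => (fun i => (w i).2.1, fun i => e' * (w i).1 + (w i).2.2))
      hΘ (by fun_prop)

theorem IsNoisyLetter.distortion_block (hN : IsNoisyLetter ρ P π v v' q)
    (hreg : IsRegression P g f f' a b c z r)
    (hCT : ∀ ω i, C (T ω) i = e * f (π (ω i)) + v (ω i)) (i : Fin n) :
    ∫⁻ ω, ENNReal.ofReal
        ((f (π (ω i)) - linearEstimator c e γ C ((fun i => f' (π (ω i))), T ω) i) ^ 2)
        ∂(Measure.pi fun _ : Fin n => ρ)
      = ENNReal.ofReal ((1 - γ * e) ^ 2 * ∫ s, r s ^ 2 ∂P + γ ^ 2 * q) := by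
  simp only [sub_linearEstimator_eq (γ := γ) hreg hCT]
  have hr := hreg.measurable_r
  have hπ := hN.measurable_π
  have hv := hN.measurable_v
  have hm : Measurable fun ω => (1 - γ * e) * r (π ω) - γ * v ω := by fun_prop
  have h1 : ∫⁻ ω : Fin n → Λ, ENNReal.ofReal (((1 - γ * e) * r (π (ω i)) - γ * v (ω i)) ^ 2)
      ∂(Measure.pi fun _ : Fin n => ρ)
      = ∫⁻ ω, ENNReal.ofReal (((1 - γ * e) * r (π ω) - γ * v ω) ^ 2) ∂ρ := by
    conv_rhs => rw [← (measurePreserving_eval (fun _ : Fin n => ρ) i).map_eq]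
    rw [lintegral_map (hm.pow_const 2).ennreal_ofReal (measurable_pi_apply i)]
  have hG := hN.hasGaussianLaw hreg
  have hr2 := hG.fst.snd.fst.memLp_two
  have hv2 := hG.snd.fst.memLp_two
  have hL : MemLp (fun ω => (1 - γ * e) * r (π ω) - γ * v ω) 2 ρ :=
    (hr2.const_mul _).sub (hv2.const_mul _)
  rw [h1, ← ofReal_integral_eq_lintegral_ofReal hL.integrable_sq (ae_of_all _ fun _ => sq_nonneg _)]
  congr 1
  have hrr : ∫ ω, r (π ω) ^ 2 ∂ρ = ∫ s, r s ^ 2 ∂P := by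
    rw [← hN.map_π, integral_map hπ.aemeasurable (hr.pow_const 2).aestronglyMeasurable]
  have hv0 : ∫ ω, v ω ∂ρ = 0 := by
    have := integral_id_gaussianReal (μ := 0) (v := q)
    rw [← hN.map_v, integral_map hv.aemeasurable (by fun_prop)] at this
    exact this
  have hvv : ∫ ω, v ω ^ 2 ∂ρ = q := by
    rw [← hN.variance_noise, variance_of_integral_eq_zero hv.aemeasurable hv0]
  have hrv : ∫ ω, r (π ω) * v ω ∂ρ = 0 := by
    have hi : IndepFun (fun ω => r (π ω)) v ρ := hN.indep_letter.comp hr measurable_fst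
    have := hi.integral_mul_eq_mul_integral (hr.comp hπ).aestronglyMeasurable
      hv.aestronglyMeasurable
    rw [hv0, mul_zero] at this
    exact this
  have hexp : ∀ ω, ((1 - γ * e) * r (π ω) - γ * v ω) ^ 2 = ((1 - γ * e) ^ 2 * r (π ω) ^ 2
      - 2 * (1 - γ * e) * γ * (r (π ω) * v ω)) + γ ^ 2 * v ω ^ 2 := fun ω => by ring
  have i1 := hr2.integrable_sq.const_mul ((1 - γ * e) ^ 2)
  have i2 : Integrable (fun ω => 2 * (1 - γ * e) * γ * (r (π ω) * v ω)) ρ :=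
    (hr2.integrable_mul hv2).const_mul _
  have i3 := hv2.integrable_sq.const_mul (γ ^ 2)
  have i12 : Integrable (fun ω => (1 - γ * e) ^ 2 * r (π ω) ^ 2
      - 2 * (1 - γ * e) * γ * (r (π ω) * v ω)) ρ := i1.sub i2
  simp only [hexp]
  rw [integral_add i12 i3, integral_sub i1 i2, integral_const_mul, integral_const_mul,
    integral_const_mul, hrr, hrv, hvv]
  ring

end Block

/-! ### The one-shot mechanism -/

/-- Whether the test channel with noise variance `Q` reveals anything. -/
def gain (Q : ℝ≥0∞) : ℝ := if Q = ∞ then 0 else 1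

/-- For Q = ∞ the gain is 0 and `toNNReal` sends ∞ to 0, so the noise is a point mass at 0. One
affine formula therefore covers the silent channel as well. -/
theorem testChannel_eq_map (Q : ℝ≥0∞) (x : ℝ) :
    testChannel Q x = (gaussianReal 0 Q.toNNReal).map fun v => gain Q * x + v := by
  unfold testChannel gain
  split_ifs with h
  · simp [h]
  · simp

theorem pi_testChannel_eq_map {n : ℕ} (Q : ℝ≥0∞) (x : Fin n → ℝ) :
    Measure.pi (fun i => testChannel Q (x i))
      = (Measure.pi fun _ : Fin n => gaussianReal 0 Q.toNNReal).map
        fun v i => gain Q * x i + v i := by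
  have := Measure.pi_map_pi (ι := Fin n) (μ := fun _ => gaussianReal 0 Q.toNNReal)
    (f := fun i v => gain Q * x i + v) (fun i => by fun_prop)
  rw [this]
  simp only [testChannel_eq_map]

/-- The memoryless test channel as a Markov kernel that does not look at the history. -/
def testKernel (Q : ℝ≥0∞) (n : ℕ) (τ : Type) [MeasurableSpace τ] :
    Kernel ((Fin n → ℝ) × τ) (Fin n → ℝ) :=
  ((Kernel.deterministic (fun p : (Fin n → ℝ) × τ => p.1) measurable_fst).prod
    (Kernel.const _ (Measure.pi fun _ : Fin n => gaussianReal 0 Q.toNNReal))).map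
    fun p i => gain Q * p.1 i + p.2 i

theorem testKernel_apply (Q : ℝ≥0∞) (n : ℕ) (τ : Type) [MeasurableSpace τ] (x : Fin n → ℝ)
    (t : τ) : testKernel Q n τ (x, t) = (Measure.pi fun _ : Fin n => gaussianReal 0 Q.toNNReal).map
      fun v i => gain Q * x i + v i := by
  rw [testKernel, Kernel.map_apply _ (by fun_prop), Kernel.prod_apply, Kernel.deterministic_apply,
    Kernel.const_apply, Measure.dirac_prod, Measure.map_map (by fun_prop) (by fun_prop)]
  rfl

instance isMarkovKernel_testKernel (Q : ℝ≥0∞) (n : ℕ) (τ : Type) [MeasurableSpace τ] :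
    IsMarkovKernel (testKernel Q n τ) := by
  unfold testKernel
  exact Kernel.IsMarkovKernel.map _ (by fun_prop)

/-- The transcript made of the first `k` entries of a sequence of real messages. -/
def transcriptOf {n : ℕ} (w : ℕ → Fin n → ℝ) : (k : ℕ) → Transcript (fun _ => ℝ) n k
  | 0 => ()
  | k + 1 => (transcriptOf w k, w k)

/-- The message of round `j` in a transcript of real messages. -/
def messageAt {n : ℕ} (j : ℕ) : (k : ℕ) → Transcript (fun _ => ℝ) n k → Fin n → ℝ
  | 0, _ => 0
  | k + 1, t => if j = k then t.2 else messageAt j k t.1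

theorem measurable_messageAt {n : ℕ} (j k : ℕ) : Measurable (messageAt (n := n) j k) := by
  induction k with
  | zero => exact measurable_const
  | succ k ih =>
    change Measurable fun t : Transcript (fun _ => ℝ) n k × (Fin n → ℝ) =>
      if j = k then t.2 else messageAt j k t.1
    split_ifs
    · exact measurable_snd
    · exact ih.comp measurable_fst

theorem messageAt_transcriptOf {n : ℕ} (w : ℕ → Fin n → ℝ) {j k : ℕ} (h : j < k) :
    messageAt j k (transcriptOf w k) = w j := by
  induction k with
  | zero => omega
  | succ k ih =>
    change (if j = k then w k else messageAt j k (transcriptOf w k)) = w j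
    split_ifs with hjk
    · rw [hjk]
    · exact ih (by omega)

theorem measurable_transcriptOf {α : Type} [MeasurableSpace α] {n : ℕ}
    {w : α → ℕ → Fin n → ℝ} (hw : ∀ j, Measurable fun x => w x j) (k : ℕ) :
    Measurable fun x => transcriptOf (w x) k := by
  induction k with
  | zero => exact measurable_const
  | succ k ih => exact ih.prodMk (hw k)

/-- The sequence of messages of a one-shot mechanism: `u₁`, `u₂`, and then nothing. -/
def oneShotMessages {n : ℕ} (u₁ u₂ : Fin n → ℝ) : ℕ → Fin n → ℝ
  | 0 => u₁
  | 1 => u₂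
  | _ + 2 => 0

/-- The channel used in the round with index `k`. -/
def roundVariance (Q₁ Q₂ : ℝ≥0∞) : ℕ → ℝ≥0∞
  | 0 => Q₁
  | 1 => Q₂
  | _ + 2 => ∞

/-- The mechanism in which the agents speak once, through Gaussian test channels, and then remain
silent; the receivers use linear estimators. -/
def oneShot (Q₁ Q₂ : ℝ≥0∞) (c₁ γ₁ c₂ γ₂ : ℝ) (n K : ℕ) : Mechanism (fun _ => ℝ) n K where
  message k := testKernel (roundVariance Q₁ Q₂ k) n (Transcript (fun _ => ℝ) n k)
  markov _ := isMarkovKernel_testKernel _ _ _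
  g₁ := linearEstimator c₁ (gain Q₁) γ₁ (messageAt 0 K)
  g₂ := linearEstimator c₂ (gain Q₂) γ₂ (messageAt 1 K)
  measurable_g₁ := measurable_linearEstimator _ _ _ (measurable_messageAt 0 K)
  measurable_g₂ := measurable_linearEstimator _ _ _ (measurable_messageAt 1 K)

theorem isOneShotGaussian_oneShot (Q₁ Q₂ : ℝ≥0∞) (c₁ γ₁ c₂ γ₂ : ℝ) (n : ℕ) :
    IsOneShotGaussian (oneShot Q₁ Q₂ c₁ γ₁ c₂ γ₂ n 2) Q₁ Q₂ := by
  refine ⟨fun x h => ?_, fun x h => ?_⟩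
  · rw [pi_testChannel_eq_map]
    exact testKernel_apply _ _ _ _ _
  · rw [pi_testChannel_eq_map]
    exact testKernel_apply _ _ _ _ _

/-- Functional representation of a kernel: its output is a deterministic function of the input and
of independent noise. This replaces composition of kernels by images of product measures. -/
theorem compProd_eq_map_prod {α β γ : Type} [MeasurableSpace α] [MeasurableSpace β]
    [MeasurableSpace γ] {μ : Measure α} [SFinite μ] {κ : Kernel α β} [IsSFiniteKernel κ]
    {ν : Measure γ} [SFinite ν] {Φ : α × γ → β} (hΦ : Measurable Φ)
    (h : ∀ x, κ x = ν.map fun v => Φ (x, v)) :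
    μ.compProd κ = (μ.prod ν).map fun p => (p.1, Φ p) := by
  have hm : Measurable fun p : α × γ => (p.1, Φ p) := measurable_fst.prodMk hΦ
  ext s hs
  rw [Measure.compProd_apply hs, Measure.map_apply hm hs, Measure.prod_apply (hm hs)]
  refine lintegral_congr fun x => ?_
  have hx : Measurable fun v => Φ (x, v) := hΦ.comp measurable_prodMk_left
  rw [h, Measure.map_apply hx (measurable_prodMk_left hs)]
  rfl

/-! ### Transcript law of the one-shot mechanism -/

section Law

variable {Q₁ Q₂ : ℝ≥0∞} {c₁ γ₁ c₂ γ₂ : ℝ} {n K : ℕ}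

/-- The law of the noise of the memoryless test channel. -/
def noiseLaw (Q : ℝ≥0∞) (n : ℕ) : Measure (Fin n → ℝ) :=
  Measure.pi fun _ => gaussianReal 0 Q.toNNReal

instance isProbabilityMeasure_noiseLaw (Q : ℝ≥0∞) (n : ℕ) :
    IsProbabilityMeasure (noiseLaw Q n) := by
  unfold noiseLaw
  infer_instance

/-- The transcript with the message `y + v` appended. -/
def extendTranscript {k : ℕ} (y : Fin n → ℝ) (p : Transcript (fun _ => ℝ) n k × (Fin n → ℝ)) :
    Transcript (fun _ => ℝ) n (k + 1) :=
  (p.1, fun i => y i + p.2 i)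

theorem measurable_extendTranscript {k : ℕ} (y : Fin n → ℝ) :
    Measurable (extendTranscript (k := k) y) :=
  measurable_fst.prodMk (by fun_prop : Measurable
    fun (p : Transcript (fun _ => ℝ) n k × (Fin n → ℝ)) i => y i + p.2 i)

theorem transcriptKernel_succ (k : ℕ) (x : (Fin n → ℝ) × (Fin n → ℝ)) :
    (oneShot Q₁ Q₂ c₁ γ₁ c₂ γ₂ n K).transcriptKernel (k + 1) x
      = (((oneShot Q₁ Q₂ c₁ γ₁ c₂ γ₂ n K).transcriptKernel k x).prod
        (noiseLaw (roundVariance Q₁ Q₂ k) n)).map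
          (extendTranscript fun i => gain (roundVariance Q₁ Q₂ k) * own k x i) := by
  set M := oneShot Q₁ Q₂ c₁ γ₁ c₂ γ₂ n K
  have := M.markov k
  have h1 : M.transcriptKernel (k + 1) x = ((M.transcriptKernel k).compProd
      ((M.message k).comap
        (fun p : ((Fin n → ℝ) × (Fin n → ℝ)) × Transcript (fun _ => ℝ) n k => (own k p.1, p.2))
        (((measurable_own k).comp measurable_fst).prodMk measurable_snd))) x := rfl
  rw [h1, Kernel.compProd_apply_eq_compProd_sectR]
  refine compProd_eq_map_prod (Φ := fun p : Transcript (fun _ => ℝ) n k × (Fin n → ℝ) => fun i =>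
    gain (roundVariance Q₁ Q₂ k) * own k x i + p.2 i) (by fun_prop) fun t => ?_
  rw [Kernel.sectR_apply, Kernel.comap_apply]
  exact testKernel_apply _ _ _ _ _

/-- The transcript of the one-shot mechanism as a function of the sources and of the noise. -/
def oneShotTranscript (Q₁ Q₂ : ℝ≥0∞) (k : ℕ) (x v : (Fin n → ℝ) × (Fin n → ℝ)) :
    Transcript (fun _ => ℝ) n k :=
  transcriptOf (oneShotMessages (fun i => gain Q₁ * x.1 i + v.1 i)
    (fun i => gain Q₂ * x.2 i + v.2 i)) k

theorem measurable_oneShotMessages (j : ℕ) : Measurable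
    fun p : (Fin n → ℝ) × (Fin n → ℝ) => oneShotMessages p.1 p.2 j := by
  match j with
  | 0 => exact measurable_fst
  | 1 => exact measurable_snd
  | _ + 2 => exact measurable_const

theorem measurable_oneShotTranscript (k : ℕ) : Measurable
    fun p : ((Fin n → ℝ) × (Fin n → ℝ)) × ((Fin n → ℝ) × (Fin n → ℝ)) =>
      oneShotTranscript Q₁ Q₂ k p.1 p.2 := by
  refine measurable_transcriptOf (fun j => ?_) k
  exact Measurable.comp (f := fun p : ((Fin n → ℝ) × (Fin n → ℝ)) × ((Fin n → ℝ) × (Fin n → ℝ)) =>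
    (fun i => gain Q₁ * p.1.1 i + p.2.1 i, fun i => gain Q₂ * p.1.2 i + p.2.2 i))
    (measurable_oneShotMessages j) (by fun_prop)

theorem measurable_oneShotTranscript_right (k : ℕ) (x : (Fin n → ℝ) × (Fin n → ℝ)) :
    Measurable (oneShotTranscript Q₁ Q₂ k x) :=
  (measurable_oneShotTranscript k).comp measurable_prodMk_left

theorem noiseLaw_top (n : ℕ) : noiseLaw ∞ n = Measure.dirac 0 := by
  unfold noiseLaw
  rw [ENNReal.toNNReal_top, gaussianReal_zero_var]
  refine Measure.pi_eq fun t ht => ?_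
  rw [Measure.dirac_apply' _ (MeasurableSet.univ_pi ht)]
  simp only [fun i => Measure.dirac_apply' (0 : ℝ) (ht i)]
  by_cases h : ∀ i, (0 : ℝ) ∈ t i
  · have h0 : (0 : Fin n → ℝ) ∈ Set.univ.pi t := fun i _ => h i
    refine (Set.indicator_of_mem h0 _).trans ?_
    exact (Finset.prod_eq_one fun i _ => Set.indicator_of_mem (h i) _).symm
  · have h0 : (0 : Fin n → ℝ) ∉ Set.univ.pi t := fun h0 => h fun i => h0 i (Set.mem_univ i)
    refine (Set.indicator_of_notMem h0 _).trans ?_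
    obtain ⟨i, hi⟩ := not_forall.1 h
    exact (Finset.prod_eq_zero (Finset.mem_univ i) (Set.indicator_of_notMem hi _)).symm

theorem map_prod_map_left {α β γ δ : Type} [MeasurableSpace α] [MeasurableSpace β]
    [MeasurableSpace γ] [MeasurableSpace δ] {μ : Measure α} [SFinite μ] {ν : Measure γ} [SFinite ν]
    {F : α → β} (hF : Measurable F) {G : β × γ → δ} (hG : Measurable G) :
    ((μ.map F).prod ν).map G = (μ.prod ν).map fun p => G (F p.1, p.2) := by
  have h := Measure.map_prod_map μ ν hF measurable_id
  rw [Measure.map_id] at h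
  rw [h, Measure.map_map hG (hF.prodMap measurable_id)]
  rfl

theorem transcriptKernel_one (x : (Fin n → ℝ) × (Fin n → ℝ)) :
    (oneShot Q₁ Q₂ c₁ γ₁ c₂ γ₂ n K).transcriptKernel 1 x
      = (noiseLaw Q₁ n).map fun v => oneShotTranscript Q₁ Q₂ 1 x (v, 0) := by
  rw [transcriptKernel_succ]
  have h0 : (oneShot Q₁ Q₂ c₁ γ₁ c₂ γ₂ n K).transcriptKernel 0 x
    = (Measure.dirac () : Measure Unit) := rfl
  rw [h0]
  refine (congrArg (Measure.map _) (Measure.dirac_prod (ν := noiseLaw (roundVariance Q₁ Q₂ 0) n)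
    ())).trans ?_
  have hm : Measurable (Prod.mk () : (Fin n → ℝ) → Unit × (Fin n → ℝ)) := by fun_prop
  refine (Measure.map_map (measurable_extendTranscript (k := 0) _) hm).trans ?_
  rfl

/-- From the third round on, gain and noise both vanish, so each further message is the constant 0
and no new noise variable is needed. -/
theorem transcriptKernel_eq_map {k : ℕ} (hk : 2 ≤ k) (x : (Fin n → ℝ) × (Fin n → ℝ)) :
    (oneShot Q₁ Q₂ c₁ γ₁ c₂ γ₂ n K).transcriptKernel k x
      = ((noiseLaw Q₁ n).prod (noiseLaw Q₂ n)).map (oneShotTranscript Q₁ Q₂ k x) := by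
  induction k, hk using Nat.le_induction with
  | base =>
    have hm : Measurable fun v : Fin n → ℝ => oneShotTranscript Q₁ Q₂ 1 x (v, 0) :=
      (measurable_oneShotTranscript_right 1 x).comp measurable_prodMk_right
    rw [transcriptKernel_succ, transcriptKernel_one,
      map_prod_map_left hm (measurable_extendTranscript _)]
    rfl
  | succ k hk ih =>
    obtain ⟨m, rfl⟩ := Nat.exists_eq_add_of_le' hk
    have hQ : roundVariance Q₁ Q₂ (m + 2) = ∞ := rfl
    have hm := (measurable_extendTranscript fun i => gain ∞ * own (m + 2) x i).comp
      ((measurable_oneShotTranscript_right (Q₁ := Q₁) (Q₂ := Q₂) (m + 2) x).prodMap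
        (measurable_id (α := Fin n → ℝ)))
    rw [transcriptKernel_succ, ih, map_prod_map_left (measurable_oneShotTranscript_right _ x)
      (measurable_extendTranscript _), hQ, noiseLaw_top, Measure.prod_dirac]
    refine (Measure.map_map hm (by fun_prop)).trans ?_
    congr 1
    funext v
    refine Prod.ext rfl ?_
    funext i
    change gain ∞ * own (m + 2) x i + 0 = 0
    simp [gain]

end Law

/-! ### Leakage and distortion of the one-shot mechanism -/

section Law

variable {P : Measure Letter} [IsProbabilityMeasure P] {Q₁ Q₂ : ℝ≥0∞} {c₁ γ₁ c₂ γ₂ : ℝ} {n K : ℕ}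

/-- The law of a letter and of the noise of the two test channels. -/
def noisyLetterLaw (P : Measure Letter) (Q₁ Q₂ : ℝ≥0∞) : Measure (Letter × ℝ × ℝ) :=
  P.prod ((gaussianReal 0 Q₁.toNNReal).prod (gaussianReal 0 Q₂.toNNReal))

instance isProbabilityMeasure_noisyLetterLaw : IsProbabilityMeasure (noisyLetterLaw P Q₁ Q₂) := by
  unfold noisyLetterLaw
  infer_instance

/-- The block outcome `(s, u)` of the one-shot mechanism as a function of the noisy letters. -/
def oneShotOutcome (Q₁ Q₂ : ℝ≥0∞) (K : ℕ) (ω : Fin n → Letter × ℝ × ℝ) :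
    (Fin n → Letter) × Transcript (fun _ => ℝ) n K :=
  (fun i => (ω i).1, transcriptOf (oneShotMessages
    (fun i => gain Q₁ * X₁ (ω i).1 + (ω i).2.1) fun i => gain Q₂ * X₂ (ω i).1 + (ω i).2.2) K)

theorem measurable_transcriptOf_oneShotMessages (K : ℕ) :
    Measurable fun p : (Fin n → ℝ) × (Fin n → ℝ) => transcriptOf (oneShotMessages p.1 p.2) K :=
  measurable_transcriptOf (fun j => measurable_oneShotMessages j) K

theorem measurable_oneShotOutcome : Measurable (oneShotOutcome (n := n) Q₁ Q₂ K) := by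
  have h1 := measurable_X₁
  have h2 := measurable_X₂
  refine Measurable.prodMk (by fun_prop) ?_
  exact (measurable_transcriptOf_oneShotMessages K).comp (f := fun ω : Fin n → Letter × ℝ × ℝ =>
    ((fun i => gain Q₁ * X₁ (ω i).1 + (ω i).2.1), fun i => gain Q₂ * X₂ (ω i).1 + (ω i).2.2))
    (by fun_prop)

/-- Sources and noise are i.i.d. across letters, so the block law is the image of n independent
noisy letters. This reduces leakage and distortion to single-letter Gaussian computations. -/
theorem law_oneShot (hK : 2 ≤ K) : (oneShot Q₁ Q₂ c₁ γ₁ c₂ γ₂ n K).law P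
    = (Measure.pi fun _ => noisyLetterLaw P Q₁ Q₂).map (oneShotOutcome Q₁ Q₂ K) := by
  have hseq : Measurable fun s : Fin n → Letter => (seq X₁ s, seq X₂ s) := by
    unfold seq X₁ X₂
    fun_prop
  have h1 := compProd_eq_map_prod (μ := Measure.pi fun _ : Fin n => P)
    (κ := ((oneShot Q₁ Q₂ c₁ γ₁ c₂ γ₂ n K).transcriptKernel K).comap
      (fun s => (seq X₁ s, seq X₂ s)) hseq) (ν := (noiseLaw Q₁ n).prod (noiseLaw Q₂ n))
    (Φ := fun p => oneShotTranscript Q₁ Q₂ K (seq X₁ p.1, seq X₂ p.1) p.2)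
    ((measurable_oneShotTranscript K).comp
      ((hseq.comp measurable_fst).prodMk measurable_snd))
    (fun s => by
      rw [Kernel.comap_apply]
      exact transcriptKernel_eq_map hK _)
  -- Sequences of triples (letter, noise, noise) are regrouped as triples of sequences: first the
  -- letter is split off, then the two noises are separated.
  have h2 := ((MeasurePreserving.id (Measure.pi fun _ : Fin n => P)).prod
    (measurePreserving_arrowProdEquivProdArrow ℝ ℝ (Fin n)
      (fun _ => gaussianReal 0 Q₁.toNNReal) fun _ => gaussianReal 0 Q₂.toNNReal)).comp
    (measurePreserving_arrowProdEquivProdArrow Letter (ℝ × ℝ) (Fin n) (fun _ => P)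
      fun _ => (gaussianReal 0 Q₁.toNNReal).prod (gaussianReal 0 Q₂.toNNReal))
  have hm : Measurable fun p : (Fin n → Letter) × (Fin n → ℝ) × (Fin n → ℝ) =>
      (p.1, oneShotTranscript Q₁ Q₂ K (seq X₁ p.1, seq X₂ p.1) p.2) :=
    measurable_fst.prodMk ((measurable_oneShotTranscript K).comp
      ((hseq.comp measurable_fst).prodMk measurable_snd))
  refine h1.trans ?_
  unfold noiseLaw
  rw [← h2.map_eq]
  exact Measure.map_map hm h2.measurable

theorem map_noise_noisyLetterLaw : (noisyLetterLaw P Q₁ Q₂).map (fun ω => (ω.2.1, ω.2.2))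
    = (gaussianReal 0 Q₁.toNNReal).prod (gaussianReal 0 Q₂.toNNReal) :=
  Measure.map_snd_prod.trans (by simp)

theorem map_noise_fst_noisyLetterLaw :
    (noisyLetterLaw P Q₁ Q₂).map (fun ω => ω.2.1) = gaussianReal 0 Q₁.toNNReal := by
  have h := Measure.map_map (μ := noisyLetterLaw P Q₁ Q₂) measurable_fst
    (by fun_prop : Measurable fun ω : Letter × ℝ × ℝ => (ω.2.1, ω.2.2))
  rw [map_noise_noisyLetterLaw, Measure.map_fst_prod, measure_univ, one_smul] at h
  exact h.symm

theorem map_noise_snd_noisyLetterLaw :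
    (noisyLetterLaw P Q₁ Q₂).map (fun ω => ω.2.2) = gaussianReal 0 Q₂.toNNReal := by
  have h := Measure.map_map (μ := noisyLetterLaw P Q₁ Q₂) measurable_snd
    (by fun_prop : Measurable fun ω : Letter × ℝ × ℝ => (ω.2.1, ω.2.2))
  rw [map_noise_noisyLetterLaw, Measure.map_snd_prod, measure_univ, one_smul] at h
  exact h.symm

theorem isNoisyLetter_fst : IsNoisyLetter (noisyLetterLaw P Q₁ Q₂) P (fun ω => ω.1)
    (fun ω => ω.2.1) (fun ω => ω.2.2) Q₁.toNNReal where
  measurable_π := by fun_prop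
  measurable_v := by fun_prop
  measurable_v' := by fun_prop
  map_π := Measure.map_fst_prod.trans (by simp)
  map_v := map_noise_fst_noisyLetterLaw
  gaussian := ⟨by
    rw [map_noise_noisyLetterLaw]
    infer_instance⟩
  indep_noise := by
    rw [indepFun_iff_map_prod_eq_prod_map_map (by fun_prop) (by fun_prop),
      map_noise_noisyLetterLaw, map_noise_fst_noisyLetterLaw, map_noise_snd_noisyLetterLaw]
  indep_letter := indepFun_prod measurable_id measurable_id

theorem isNoisyLetter_snd : IsNoisyLetter (noisyLetterLaw P Q₁ Q₂) P (fun ω => ω.1)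
    (fun ω => ω.2.2) (fun ω => ω.2.1) Q₂.toNNReal where
  measurable_π := by fun_prop
  measurable_v := by fun_prop
  measurable_v' := by fun_prop
  map_π := isNoisyLetter_fst.map_π
  map_v := map_noise_snd_noisyLetterLaw
  gaussian := isNoisyLetter_fst.gaussian.map_fun
    ((ContinuousLinearMap.snd ℝ ℝ ℝ).prod (ContinuousLinearMap.fst ℝ ℝ ℝ))
  indep_noise := isNoisyLetter_fst.indep_noise.symm
  indep_letter := isNoisyLetter_fst.indep_letter.comp measurable_id measurable_swap

/-- The leakage of the private letter `g` under a block mechanism whose law is that of noisy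
letters. -/
theorem leakage_le_of_isNoisyLetter {τ : Type} [MeasurableSpace τ] {g f f' z r : Letter → ℝ}
    {a b c e e' γ : ℝ} {v v' : Letter × ℝ × ℝ → ℝ} {q : ℝ≥0}
    (hN : IsNoisyLetter (noisyLetterLaw P Q₁ Q₂) P (fun ω => ω.1) v v' q)
    (hreg : IsRegression P g f f' a b c z r) (hG : HasGaussianLaw g P) (hg0 : ∫ s, g s ∂P = 0)
    (hvar : 0 < variance g P) {D L : ℝ} (hL : LeakageBound P g f f' a D L)
    (hγ : e * (1 - γ * e) * ∫ s, r s ^ 2 ∂P = γ * q)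
    (hD : (1 - γ * e) ^ 2 * ∫ s, r s ^ 2 ∂P + γ ^ 2 * q = min D (∫ s, r s ^ 2 ∂P))
    {Θ : (Fin n → ℝ) → (Fin n → ℝ) → τ}
    (hΘ : Measurable fun p : (Fin n → ℝ) × (Fin n → ℝ) => Θ p.1 p.2)
    {Ψ : (Fin n → Letter × ℝ × ℝ) → (Fin n → Letter) × τ} (hΨm : Measurable Ψ)
    (hΨ : ∀ ω, Ψ ω = (fun i => (ω i).1, Θ (fun i => e * f (ω i).1 + v (ω i))
      (fun i => e' * f' (ω i).1 + v' (ω i))))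
    {C : τ → Fin n → ℝ} (hC : Measurable C) (hCT : ∀ u u', C (Θ u u') = u) (hn : n ≠ 0) :
    mutualInfo ((Measure.pi fun _ => noisyLetterLaw P Q₁ Q₂).map Ψ) (fun p => seq g p.1) (view f')
        / (n : ℝ≥0∞)
      ≤ ENNReal.ofReal (1 / 2 * Real.log (variance g P / errorVar P g f f' a D)) := by
  have hg : Measurable g := by
    have h1 := hreg.measurable_f
    have h2 := hreg.measurable_f'
    have h3 := hreg.measurable_z
    rw [funext hreg.eq_g]
    fun_prop
  have hs : (variance g P).toNNReal ≠ 0 := (Real.toNNReal_pos.2 hvar).ne'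
  have hd : (errorVar P g f f' a D).toNNReal ≠ 0 := (Real.toNNReal_pos.2 hL.1).ne'
  have hgs : P.map g = gaussianReal 0 (variance g P).toNNReal := by
    rw [hG.map_eq_gaussianReal, hg0]
  have herr : errorVar P g f f' a D
      = a ^ 2 * min D (∫ s, r s ^ 2 ∂P) + ∫ s, z s ^ 2 ∂P := by
    rw [errorVar, hreg.condVar_f, hreg.condVar_g]
  have key := hN.mutualInfo_block hreg hγ hΘ (T := fun ω => (Ψ ω).2)
    (fun ω => by rw [hΨ]) hC (fun ω i => by rw [hΨ, hCT]) hs hgs hd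
    (by rw [Real.coe_toNNReal _ hL.1.le, herr, hD])
  rw [Real.coe_toNNReal _ hvar.le, Real.coe_toNNReal _ hL.1.le] at key
  have hgseq : Measurable fun p : (Fin n → Letter) × τ => seq g p.1 :=
    (measurable_seq hg).comp measurable_fst
  rw [mutualInfo_map hΨm hgseq (measurable_view hreg.measurable_f')]
  have h1 : (fun ω => seq g (Ψ ω).1) = fun ω i => g (ω i).1 := by
    funext ω i
    rw [hΨ, seq]
  have h2 : (fun ω => view f' (Ψ ω)) = fun ω => ((fun i => f' (ω i).1), (Ψ ω).2) := by
    funext ω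
    refine Prod.ext ?_ rfl
    funext i
    simp only [view, seq, hΨ]
  rw [h1, h2, key, ENNReal.ofReal_mul (Nat.cast_nonneg n), ENNReal.ofReal_natCast, mul_comm,
    ENNReal.mul_div_cancel_right (by simpa using hn) (ENNReal.natCast_ne_top n)]

/-- The distortion of the linear estimator under a block mechanism whose law is that of noisy
letters. -/
theorem distortion_le_of_isNoisyLetter {τ : Type} [MeasurableSpace τ] {g f f' z r : Letter → ℝ}
    {a b c e e' γ : ℝ} {v v' : Letter × ℝ × ℝ → ℝ} {q : ℝ≥0}
    (hN : IsNoisyLetter (noisyLetterLaw P Q₁ Q₂) P (fun ω => ω.1) v v' q)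
    (hreg : IsRegression P g f f' a b c z r) {D : ℝ}
    (hD : (1 - γ * e) ^ 2 * ∫ s, r s ^ 2 ∂P + γ ^ 2 * q = min D (∫ s, r s ^ 2 ∂P))
    {Θ : (Fin n → ℝ) → (Fin n → ℝ) → τ}
    {Ψ : (Fin n → Letter × ℝ × ℝ) → (Fin n → Letter) × τ} (hΨm : Measurable Ψ)
    (hΨ : ∀ ω, Ψ ω = (fun i => (ω i).1, Θ (fun i => e * f (ω i).1 + v (ω i))
      (fun i => e' * f' (ω i).1 + v' (ω i))))
    {C : τ → Fin n → ℝ} (hC : Measurable C) (hCT : ∀ u u', C (Θ u u') = u) (hn : n ≠ 0) :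
    (∑ i, ∫⁻ p, ENNReal.ofReal ((f (p.1 i) - linearEstimator c e γ C (view f' p) i) ^ 2)
        ∂((Measure.pi fun _ => noisyLetterLaw P Q₁ Q₂).map Ψ)) / (n : ℝ≥0∞)
      ≤ ENNReal.ofReal D := by
  have hf := hreg.measurable_f
  have hm : ∀ i, Measurable fun p : (Fin n → Letter) × τ =>
      ENNReal.ofReal ((f (p.1 i) - linearEstimator c e γ C (view f' p) i) ^ 2) := by
    intro i
    have h1 : Measurable fun p : (Fin n → Letter) × τ => linearEstimator c e γ C (view f' p) i :=
      (measurable_pi_apply i).comp ((measurable_linearEstimator c e γ hC).comp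
        (measurable_view hreg.measurable_f'))
    fun_prop
  have hi : ∀ i, ∫⁻ p, ENNReal.ofReal ((f (p.1 i) - linearEstimator c e γ C (view f' p) i) ^ 2)
        ∂((Measure.pi fun _ => noisyLetterLaw P Q₁ Q₂).map Ψ)
      = ENNReal.ofReal (min D (∫ s, r s ^ 2 ∂P)) := by
    intro i
    rw [lintegral_map (hm i) hΨm, ← hD]
    refine Eq.trans (lintegral_congr fun ω => ?_) (hN.distortion_block hreg
      (T := fun ω => (Ψ ω).2) (C := C) (e := e) (fun ω i => by rw [hΨ, hCT]) i)
    simp only [hΨ]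
    rfl
  simp only [hi, Finset.sum_const, Finset.card_univ, Fintype.card_fin, nsmul_eq_mul]
  rw [mul_comm, ENNReal.mul_div_cancel_right (by simpa using hn) (ENNReal.natCast_ne_top n)]
  exact ENNReal.ofReal_le_ofReal (min_le_left _ _)

end Law

/-- For D < σ the variance Q = Dσ/(σ − D) solves 1/D = 1/σ + 1/Q, and γ = 1 − D/σ = σ/(σ + Q) is the
optimal linear gain; D = 0 gives a noiseless channel. For D ≥ σ, silence and γ = 0 leave the error
σ. -/
theorem exists_testChannel {D σ : ℝ} (hD : 0 ≤ D) (hσ : 0 ≤ σ) :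
    ∃ (Q : ℝ≥0∞) (γ : ℝ), (D < σ → Q ≠ ∞) ∧
      gain Q * (1 - γ * gain Q) * σ = γ * (Q.toNNReal : ℝ) ∧
      (1 - γ * gain Q) ^ 2 * σ + γ ^ 2 * (Q.toNNReal : ℝ) = min D σ := by
  by_cases h : D < σ
  · have hσD : 0 < σ - D := sub_pos.2 h
    have hσ0 : σ ≠ 0 := (hD.trans_lt h).ne'
    have hq : 0 ≤ D * σ / (σ - D) := by positivity
    have hg : gain (ENNReal.ofReal (D * σ / (σ - D))) = 1 := if_neg ENNReal.ofReal_ne_top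
    have hq' : ((ENNReal.ofReal (D * σ / (σ - D))).toNNReal : ℝ) = D * σ / (σ - D) :=
      ENNReal.toReal_ofReal hq
    refine ⟨ENNReal.ofReal (D * σ / (σ - D)), 1 - D / σ, fun _ => ENNReal.ofReal_ne_top, ?_, ?_⟩
    · rw [hg, hq']
      have := hσD.ne'
      field_simp
      ring
    · rw [hg, hq', min_eq_left h.le]
      have := hσD.ne'
      field_simp
      ring
  · refine ⟨∞, 0, fun h' => absurd h' h, ?_, ?_⟩
    · simp [gain]
    · simp [gain, min_eq_right (not_lt.1 h)]

theorem limsup_le_of_forall_le {u : ℕ → ℝ≥0∞} {x y : ℝ} (hx : 0 ≤ x) (hyx : y ≤ x)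
    (h : ∀ n, n ≠ 0 → u n ≤ ENNReal.ofReal y) :
    ((limsup u atTop : ℝ≥0∞) : EReal) ≤ (x : EReal) := by
  have h1 : limsup u atTop ≤ ENNReal.ofReal x := by
    refine limsup_le_of_le (by isBoundedDefault) ?_
    filter_upwards [eventually_ne_atTop 0] with n hn
    exact (h n hn).trans (ENNReal.ofReal_le_ofReal hyx)
  rw [← EReal.coe_ennreal_le_coe_ennreal_iff, EReal.coe_ennreal_ofReal, max_eq_left hx] at h1
  exact h1

/-- Needed because an extended nonnegative limsup can be compared with L through `ENNReal.ofReal`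
only when L ≥ 0. -/
theorem LeakageBound.nonneg {P : Measure Letter} [IsProbabilityMeasure P]
    {g f f' z r : Letter → ℝ} {a b c D L : ℝ} (hL : LeakageBound P g f f' a D L)
    (hreg : IsRegression P g f f' a b c z r) : 0 ≤ L := by
  refine le_trans ?_ hL.2
  have := Real.log_nonneg ((one_le_div hL.1).2 (hreg.errorVar_le_variance D))
  linarith

/-! ### Converse and achievability for both agents -/

namespace IsGaussianSource

variable {P : Measure Letter}

theorem exists_regression₁ (hP : IsGaussianSource P) {a : ℝ}
    (ha : IsRegressionCoeff P Y₁ X₁ X₂ a) : ∃ b c z r, IsRegression P Y₁ X₁ X₂ a b c z r := by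
  have := hP.gaussian
  let A : Letter →L[ℝ] ℝ × ℝ × ℝ := LinearMap.toContinuousLinearMap
    { toFun := fun s => (Y₁ s, X₁ s, X₂ s)
      map_add' := fun _ _ => rfl
      map_smul' := fun _ _ => rfl }
  have hG : HasGaussianLaw (fun s => (Y₁ s, X₁ s, X₂ s)) P := IsGaussian.hasGaussianLaw_id.map_fun A
  exact exists_isRegression measurable_Y₁ measurable_X₁ measurable_X₂ hG hP.mean_Y₁ hP.mean_X₁
    hP.mean_X₂ ha

theorem exists_regression₂ (hP : IsGaussianSource P) {a : ℝ}
    (ha : IsRegressionCoeff P Y₂ X₂ X₁ a) : ∃ b c z r, IsRegression P Y₂ X₂ X₁ a b c z r := by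
  have := hP.gaussian
  let A : Letter →L[ℝ] ℝ × ℝ × ℝ := LinearMap.toContinuousLinearMap
    { toFun := fun s => (Y₂ s, X₂ s, X₁ s)
      map_add' := fun _ _ => rfl
      map_smul' := fun _ _ => rfl }
  have hG : HasGaussianLaw (fun s => (Y₂ s, X₂ s, X₁ s)) P := IsGaussian.hasGaussianLaw_id.map_fun A
  exact exists_isRegression measurable_Y₂ measurable_X₂ measurable_X₁ hG hP.mean_Y₂ hP.mean_X₂
    hP.mean_X₁ ha

theorem hasGaussianLaw_Y₁ (hP : IsGaussianSource P) : HasGaussianLaw Y₁ P := by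
  have := hP.gaussian
  exact (IsGaussian.hasGaussianLaw_id (μ := P)).map_fun
    ((ContinuousLinearMap.fst ℝ ℝ (ℝ × ℝ)).comp (ContinuousLinearMap.snd ℝ ℝ (ℝ × ℝ × ℝ)))

theorem hasGaussianLaw_Y₂ (hP : IsGaussianSource P) : HasGaussianLaw Y₂ P := by
  have := hP.gaussian
  exact (IsGaussian.hasGaussianLaw_id (μ := P)).map_fun
    ((ContinuousLinearMap.snd ℝ ℝ ℝ).comp ((ContinuousLinearMap.snd ℝ ℝ (ℝ × ℝ)).comp
      (ContinuousLinearMap.snd ℝ ℝ (ℝ × ℝ × ℝ))))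

end IsGaussianSource

/-- The converse: an achievable tuple obeys both leakage bounds. -/
theorem IsGaussianSource.leakageBound_of_achieves {P : Measure Letter} (hP : IsGaussianSource P)
    (hY₁ : 0 < variance Y₁ P) (hY₂ : 0 < variance Y₂ P) {α β : ℝ}
    (hα : IsRegressionCoeff P Y₁ X₁ X₂ α) (hβ : IsRegressionCoeff P Y₂ X₂ X₁ β) {K : ℕ}
    {𝒰 : ℕ → Type} [∀ k, MeasurableSpace (𝒰 k)] {M : ∀ n, Mechanism 𝒰 n K} {L₁ L₂ D₁ D₂ : ℝ}
    (h : Achieves M P L₁ L₂ D₁ D₂) :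
    0 ≤ D₁ ∧ 0 ≤ D₂ ∧ LeakageBound P Y₁ X₁ X₂ α D₁ L₁ ∧ LeakageBound P Y₂ X₂ X₁ β D₂ L₂ := by
  have hPG := hP.gaussian
  obtain ⟨b₁, c₁, z₁, r₁, hreg₁⟩ := hP.exists_regression₁ hα
  obtain ⟨b₂, c₂, z₂, r₂, hreg₂⟩ := hP.exists_regression₂ hβ
  obtain ⟨hD₁, hD₂, hL₁, hL₂⟩ := h
  have h1 := leakageBound_of_limsup_le hreg₁ hP.hasGaussianLaw_Y₁ hP.mean_Y₁ hY₁
    (μ := fun n => (M n).law P) (fun n => map_fst_law (M n))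
    (fun n => indepFun_seq_law (M n) hreg₁.measurable_z hreg₁.indep_z)
    (fun n => (M n).measurable_g₁) hD₁ hL₁
  have h2 := leakageBound_of_limsup_le hreg₂ hP.hasGaussianLaw_Y₂ hP.mean_Y₂ hY₂
    (μ := fun n => (M n).law P) (fun n => map_fst_law (M n))
    -- For agent B's private data the public letters exchange roles, so the pair of public sequences
    -- has to be swapped on both sides of the independence statement.
    (fun n => (indepFun_seq_law (M n) hreg₂.measurable_z
      (hreg₂.indep_z.comp measurable_id measurable_swap)).comp
        (ψ := fun p : ((Fin n → ℝ) × (Fin n → ℝ)) × Transcript 𝒰 n K => ((p.1.2, p.1.1), p.2))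
        measurable_id (by fun_prop))
    (fun n => (M n).measurable_g₂) hD₂ hL₂
  exact ⟨h1.1, h2.1, h1.2, h2.2⟩

/-- Achievability: for suitable noise variances and estimators, the one-shot mechanism meets all
levels allowed by the leakage bounds. -/
theorem IsGaussianSource.exists_oneShot_achieves {P : Measure Letter} (hP : IsGaussianSource P)
    (hY₁ : 0 < variance Y₁ P) (hY₂ : 0 < variance Y₂ P) {α β : ℝ}
    (hα : IsRegressionCoeff P Y₁ X₁ X₂ α) (hβ : IsRegressionCoeff P Y₂ X₂ X₁ β) {D₁ D₂ : ℝ}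
    (hD₁ : 0 ≤ D₁) (hD₂ : 0 ≤ D₂) :
    ∃ (Q₁ Q₂ : ℝ≥0∞) (c₁ γ₁ c₂ γ₂ : ℝ),
      (D₁ < meanCondVar P X₁ X₂ → Q₁ ≠ ∞) ∧ (D₂ < meanCondVar P X₂ X₁ → Q₂ ≠ ∞) ∧
      ∀ K, 2 ≤ K → ∀ L₁ L₂ : ℝ,
        LeakageBound P Y₁ X₁ X₂ α D₁ L₁ → LeakageBound P Y₂ X₂ X₁ β D₂ L₂ →
        Achieves (fun n => oneShot Q₁ Q₂ c₁ γ₁ c₂ γ₂ n K) P L₁ L₂ D₁ D₂ := by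
  have hPG := hP.gaussian
  obtain ⟨b₁, c₁, z₁, r₁, hreg₁⟩ := hP.exists_regression₁ hα
  obtain ⟨b₂, c₂, z₂, r₂, hreg₂⟩ := hP.exists_regression₂ hβ
  obtain ⟨Q₁, γ₁, hQ₁, hγ₁, hE₁⟩ :=
    exists_testChannel hD₁ (σ := ∫ s, r₁ s ^ 2 ∂P) (integral_nonneg fun _ => sq_nonneg _)
  obtain ⟨Q₂, γ₂, hQ₂, hγ₂, hE₂⟩ :=
    exists_testChannel hD₂ (σ := ∫ s, r₂ s ^ 2 ∂P) (integral_nonneg fun _ => sq_nonneg _)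
  refine ⟨Q₁, Q₂, c₁, γ₁, c₂, γ₂, hreg₁.condVar_f ▸ hQ₁, hreg₂.condVar_f ▸ hQ₂,
    fun K hK L₁ L₂ hL₁ hL₂ => ?_⟩
  have hΘ : ∀ n, Measurable fun p : (Fin n → ℝ) × (Fin n → ℝ) =>
      transcriptOf (oneShotMessages p.1 p.2) K := fun n =>
    measurable_transcriptOf_oneShotMessages K
  have hΘ' : ∀ n, Measurable fun p : (Fin n → ℝ) × (Fin n → ℝ) =>
      transcriptOf (oneShotMessages p.2 p.1) K := fun n => (hΘ n).comp measurable_swap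
  refine ⟨limsup_le_of_forall_le hD₁ le_rfl fun n hn => ?_,
    limsup_le_of_forall_le hD₂ le_rfl fun n hn => ?_,
    limsup_le_of_forall_le (hL₁.nonneg hreg₁) hL₁.2 fun n hn => ?_,
    limsup_le_of_forall_le (hL₂.nonneg hreg₂) hL₂.2 fun n hn => ?_⟩
  · rw [Mechanism.distortion₁, law_oneShot hK]
    exact distortion_le_of_isNoisyLetter isNoisyLetter_fst hreg₁ hE₁
      (Θ := fun u u' => transcriptOf (oneShotMessages u u') K)
      measurable_oneShotOutcome (fun ω => rfl) (measurable_messageAt 0 K)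
      (fun u u' => messageAt_transcriptOf _ (by omega)) hn
  · rw [Mechanism.distortion₂, law_oneShot hK]
    exact distortion_le_of_isNoisyLetter isNoisyLetter_snd hreg₂ hE₂
      (Θ := fun u u' => transcriptOf (oneShotMessages u' u) K)
      measurable_oneShotOutcome (fun ω => rfl) (measurable_messageAt 1 K)
      (fun u u' => messageAt_transcriptOf _ (by omega)) hn
  · rw [Mechanism.leakage₁, law_oneShot hK]
    exact leakage_le_of_isNoisyLetter isNoisyLetter_fst hreg₁ hP.hasGaussianLaw_Y₁ hP.mean_Y₁ hY₁
      hL₁ hγ₁ hE₁ (Θ := fun u u' => transcriptOf (oneShotMessages u u') K) (hΘ n)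
      measurable_oneShotOutcome (fun ω => rfl) (measurable_messageAt 0 K)
      (fun u u' => messageAt_transcriptOf _ (by omega)) hn
  · rw [Mechanism.leakage₂, law_oneShot hK]
    exact leakage_le_of_isNoisyLetter isNoisyLetter_snd hreg₂ hP.hasGaussianLaw_Y₂ hP.mean_Y₂ hY₂
      hL₂ hγ₂ hE₂ (Θ := fun u u' => transcriptOf (oneShotMessages u' u) K) (hΘ' n)
      measurable_oneShotOutcome (fun ω => rfl) (measurable_messageAt 1 K)
      (fun u u' => messageAt_transcriptOf _ (by omega)) hn

end PrivateInteraction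

end

theorem theorem2 (P : MeasureTheory.Measure Letter) (hP : IsGaussianSource P)
    (hY₁ : 0 < variance Y₁ P) (hY₂ : 0 < variance Y₂ P)
    (α β : ℝ) (hα : IsRegressionCoeff P Y₁ X₁ X₂ α) (hβ : IsRegressionCoeff P Y₂ X₂ X₁ β) :
    -- the region of `K`-round mechanisms, for each number of rounds
    (∀ K : ℕ, 0 < K → Even K → ∀ L₁ L₂ D₁ D₂ : ℝ,
      Achievable P K L₁ L₂ D₁ D₂ ↔
        0 ≤ D₁ ∧ 0 ≤ D₂ ∧
        LeakageBound P Y₁ X₁ X₂ α D₁ L₁ ∧ LeakageBound P Y₂ X₂ X₁ β D₂ L₂) ∧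
    -- it is attained by one-shot Gaussian test channels
    (∀ D₁ D₂ : ℝ, 0 ≤ D₁ → 0 ≤ D₂ → ∃ Q₁ Q₂ : ENNReal,
      (D₁ < meanCondVar P X₁ X₂ → Q₁ ≠ ⊤) ∧ (D₂ < meanCondVar P X₂ X₁ → Q₂ ≠ ⊤) ∧
      ∃ M : ∀ n, Mechanism (fun _ => ℝ) n 2, (∀ n, IsOneShotGaussian (M n) Q₁ Q₂) ∧
        ∀ L₁ L₂ : ℝ,
          LeakageBound P Y₁ X₁ X₂ α D₁ L₁ → LeakageBound P Y₂ X₂ X₁ β D₂ L₂ →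
          Achieves M P L₁ L₂ D₁ D₂) := by
  refine ⟨fun K hK hKe L₁ L₂ D₁ D₂ => ⟨?_, ?_⟩, fun D₁ D₂ hD₁ hD₂ => ?_⟩
  · rintro ⟨𝒰, _, M, hM⟩
    exact hP.leakageBound_of_achieves hY₁ hY₂ hα hβ hM
  · rintro ⟨hD₁, hD₂, hL₁, hL₂⟩
    obtain ⟨Q₁, Q₂, c₁, γ₁, c₂, γ₂, -, -, h⟩ :=
      hP.exists_oneShot_achieves hY₁ hY₂ hα hβ hD₁ hD₂
    -- Two rounds are needed so that each agent speaks once; evenness excludes K = 1.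
    have hK2 : 2 ≤ K := Nat.le_of_dvd hK hKe.two_dvd
    exact ⟨fun _ => ℝ, fun _ => inferInstance, _, h K hK2 L₁ L₂ hL₁ hL₂⟩
  · obtain ⟨Q₁, Q₂, c₁, γ₁, c₂, γ₂, hQ₁, hQ₂, h⟩ :=
      hP.exists_oneShot_achieves hY₁ hY₂ hα hβ hD₁ hD₂
    exact ⟨Q₁, Q₂, hQ₁, hQ₂, _, fun n => isOneShotGaussian_oneShot Q₁ Q₂ c₁ γ₁ c₂ γ₂ n,
      fun L₁ L₂ hL₁ hL₂ => h 2 le_rfl L₁ L₂ hL₁ hL₂⟩
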